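/- Let $K$ be a global field (a number field, or a finite extension of $\mathbb{F}_p(t)$ for some prime $p$) with $\mathrm{char}(K)\neq 2,3,5$. For a place $v$ of $K$ let $K_v$ be the completion of $K$ at $v$; let $\mathfrak{o}_v$ be the valuation ring of $K_v$ if $v$ is nonarchimedean, and $\mathfrak{o}_v=K_v$ if $v$ is archimedean. Let $A$ be either the adele ring $\mathbb{A}_K$ of $K$ (the restricted product of all $K_v$ with respect to the rings $\mathfrak{o}_v$), or the product ring $\prod_{v\in\mathcal{P}}\mathfrak{o}_v$ for an arbitrary non-empty set $\mathcal{P}$ of places of $K$. **Theorem.** The ring $A$ is bi-interpretable with each of the groups $\mathrm{SL}_2(A)$, $\mathrm{SL}_2(A)/\langle -1\rangle$ and $\mathrm{PSL}_2(A)=\mathrm{SL}_2(A)/\mathrm{Z}(\mathrm{SL}_2(A))$. Here rings and groups are structures for the first-order languages of rings and of groups respectively, and definable means first-order definable with parameters. An interpretation of a structure $N$ in a structure $M$ is a surjection $f:X\to N$ from a definable set $X\subseteq M^d$, for some $d\in\mathbb{N}$, such that the inverse images under $f$ of equality, of the graphs of the basic operations and of the basic relations of $N$ are definable in $M$. The structures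 $M$ and $N$ are bi-interpretable if there are an interpretation $f$ of $N$ in $M$ and an interpretation $g$ of $M$ in $N$ such that the graph of the composite interpretation of $M$ in $M$, $(x_1,\dots,x_e)\mapsto g(f(x_1),\dots,f(x_e))$, is definable in $M$, and the graph of the composite interpretation of $N$ in $N$ is definable in $N$. -/

import Mathlib

open FirstOrder

/-! ### Interpretations and bi-interpretations -/

namespace FirstOrder.Language

universe u v u' v' w w'

/-- The tuples of length `k` of elements of `dom ⊆ M ^ d` whose image under `f : dom → N`
lies in `S ⊆ N ^ k`. Such a tuple is a `k × d` array of elements of `M`. -/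
def pullback {M : Type w} {N : Type w'} {d : ℕ} {dom : Set (Fin d → M)} (f : dom → N)
    {k : ℕ} (S : Set (Fin k → N)) : Set (Fin k × Fin d → M) :=
  {z | ∃ h : ∀ i, (fun j => z (i, j)) ∈ dom, (fun i => f ⟨fun j => z (i, j), h i⟩) ∈ S}

/-- An interpretation (with parameters) of the `L'`-structure `N` in the `L`-structure `M`:
a surjection onto `N` from a definable set of `dim`-tuples of elements of `M`, such that the
inverse images of equality, of the graph of each function symbol and of each relation
symbol of `L'` are definable in `M`. -/
structure Interpretation (L : Language.{u, v}) (M : Type w) [L.Structure M]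
    (L' : Language.{u', v'}) (N : Type w') [L'.Structure N] where
  /-- The length of the tuples. -/
  dim : ℕ
  /-- The tuples that represent an element of `N`. -/
  dom : Set (Fin dim → M)
  /-- The element that a tuple represents. -/
  map : dom → N
  surjective : Function.Surjective map
  definable_dom : (Set.univ : Set M).Definable L dom
  definable_eq : (Set.univ : Set M).Definable L
    (pullback map {y : Fin 2 → N | y 0 = y 1})
  definable_fun : ∀ (k : ℕ) (F : L'.Functions k), (Set.univ : Set M).Definable L
    (pullback map {y : Fin (k + 1) → N |
      Structure.funMap F (fun i : Fin k => y i.castSucc) = y (Fin.last k)})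
  definable_rel : ∀ (k : ℕ) (R : L'.Relations k), (Set.univ : Set M).Definable L
    (pullback map {y : Fin k → N | Structure.RelMap R y})

/-- The graph of the composite of an interpretation `I` of `N` in `M` with an interpretation
`J` of `M` in `N`. The composite is a partial map from `J.dim`-tuples of `I.dim`-tuples of
elements of `M` onto `M`; the coordinate `none` holds its value. -/
def Interpretation.compGraph {L : Language.{u, v}} {M : Type w} [L.Structure M]
    {L' : Language.{u', v'}} {N : Type w'} [L'.Structure N]
    (I : Interpretation L M L' N) (J : Interpretation L' N L M) :
    Set (Option (Fin J.dim × Fin I.dim) → M) :=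
  {z | ∃ (hI : ∀ j, (fun i => z (some (j, i))) ∈ I.dom)
    (hJ : (fun j => I.map ⟨fun i => z (some (j, i)), hI j⟩) ∈ J.dom),
      J.map ⟨fun j => I.map ⟨fun i => z (some (j, i)), hI j⟩, hJ⟩ = z none}

/-- `M` and `N` are bi-interpretable (with parameters): each has an interpretation in the
other such that both composites, of `M` in `M` and of `N` in `N`, are definable. -/
def BiInterpretable (L : Language.{u, v}) (M : Type w) [L.Structure M]
    (L' : Language.{u', v'}) (N : Type w') [L'.Structure N] : Prop :=
  ∃ (I : Interpretation L M L' N) (J : Interpretation L' N L M),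
    (Set.univ : Set M).Definable L (I.compGraph J) ∧
    (Set.univ : Set N).Definable L' (J.compGraph I)

/-- The function symbols of the language of groups. -/
inductive GroupFunc : ℕ → Type
  | mul : GroupFunc 2
  | inv : GroupFunc 1
  | one : GroupFunc 0

/-- The language of groups. -/
def gp : Language := ⟨GroupFunc, fun _ => Empty⟩

/-- A group as a structure for the language of groups. -/
abbrev gpStructure (G : Type w) [Group G] : gp.Structure G where
  funMap {_} F := match F with
    | .mul => fun x => x 0 * x 1
    | .inv => fun x => (x 0)⁻¹
    | .one => fun _ => 1
  RelMap {_} R := nomatch R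

/-- The ring `A` (in the language of rings) and the group `G` (in the language of groups)
are bi-interpretable. -/
def RingGroupBiInterpretable (A : Type w) [CommRing A] (G : Type w') [Group G] : Prop :=
  letI : Language.ring.Structure A := (Ring.compatibleRingOfRing A).toStructure
  letI : gp.Structure G := gpStructure G
  BiInterpretable Language.ring A gp G

end FirstOrder.Language

/-! ### Global fields, their places and completions -/

namespace GlobalField

universe u

/-- A global field: a number field, or a finite extension of `𝔽_p(t)` for some prime `p`. -/
def IsGlobalField (K : Type u) [Field K] : Prop :=
  NumberField K ∨
    ∃ (p : ℕ) (_ : Fact p.Prime) (_ : Algebra (RatFunc (ZMod p)) K),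
      FiniteDimensional (RatFunc (ZMod p)) K

/-- A nonarchimedean place of a global field `K`, given by its normalized valuation
(written multiplicatively): a valuation of `K` onto `ℤ ∪ {∞}`. -/
def FinitePlace (K : Type u) [Field K] : Type u :=
  {v : Valuation K (WithZero (Multiplicative ℤ)) // Function.Surjective v}

/-- The places of a global field `K`: the nonarchimedean and the archimedean ones. (A function
field has no archimedean place, its places `at infinity' are of the first kind.) -/
abbrev Place (K : Type u) [Field K] : Type u :=
  FinitePlace K ⊕ NumberField.InfinitePlace K

variable {K : Type u} [Field K]

/-- The completion `K_v` of `K` at the place `v`. -/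
def Place.Completion : Place K → Type u
  | .inl v => v.1.Completion
  | .inr w => w.Completion

noncomputable instance (v : Place K) : Field v.Completion :=
  match v with
  | .inl v => inferInstanceAs (Field v.1.Completion)
  | .inr w => inferInstanceAs (Field w.Completion)

/-- The ring of local integers `𝔬_v`: the valuation ring of `K_v` if `v` is nonarchimedean,
and the field `K_v` itself if `v` is archimedean. -/
noncomputable def Place.integers (v : Place K) : Subring v.Completion :=
  match v with
  | .inl v => (Valued.v : Valuation v.1.Completion (WithZero (Multiplicative ℤ))).integer
  | .inr _ => ⊤

variable (K) in
/-- The adele ring of `K`: the restricted product of all `K_v` with respect to the `𝔬_v`. -/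
abbrev AdeleRing : Type u :=
  RestrictedProduct (fun v : Place K => v.Completion) (fun v => (v.integers : Set v.Completion))
    Filter.cofinite

/-- The product of the local rings `𝔬_v` over a set `P` of places. -/
abbrev IntegerProduct (P : Set (Place K)) : Type u :=
  (v : P) → (v : Place K).integers

end GlobalField

/-! ### The groups of type `SL₂` -/

open Matrix in
/-- The subgroup `⟨-1⟩` of `SL₂(A)` is normal. -/
instance zpowers_neg_one_normal (A : Type*) [CommRing A] :
    (Subgroup.zpowers (-1 : SpecialLinearGroup (Fin 2) A)).Normal := by
  have h : Subgroup.zpowers (-1 : SpecialLinearGroup (Fin 2) A) ≤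
      Subgroup.center (SpecialLinearGroup (Fin 2) A) := by
    rw [Subgroup.zpowers_le, Subgroup.mem_center_iff]
    intro g
    simp
  refine ⟨fun n hn g => ?_⟩
  rw [Subgroup.mem_center_iff.1 (h hn) g, mul_inv_cancel_right]
  exact hn

/-- `A` is bi-interpretable with each of the groups `SL₂(A)`, `SL₂(A)/⟨-1⟩` and `PSL₂(A)`,
the last being the quotient of `SL₂(A)` by its centre. -/
def BiInterpretableWithSL2s (A : Type*) [CommRing A] : Prop :=
  Language.RingGroupBiInterpretable A (Matrix.SpecialLinearGroup (Fin 2) A) ∧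
  Language.RingGroupBiInterpretable A
    (Matrix.SpecialLinearGroup (Fin 2) A ⧸
      Subgroup.zpowers (-1 : Matrix.SpecialLinearGroup (Fin 2) A)) ∧
  Language.RingGroupBiInterpretable A (Matrix.ProjectiveSpecialLinearGroup (Fin 2) A)

/-! ### Definable sets and functions -/

namespace FirstOrder.Language

section Kit

variable {L : Language} {M : Type*} [L.Structure M] {α β : Type*}

/-! Everything about `A` that matters is collected in `UnitRich`; the rest is done for any quotient
`G` of `SL₂(A)` by a central subgroup definable in `A`. In one direction, `G` is interpreted in `A`
by matrix entries modulo the kernel. In the other, `A` is interpreted in `G` by the root group, the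
image of the upper unitriangular matrices, where addition is the group law.

The root group is definable because squares of elements centralizing `upper 1` are upper
unitriangular and include all `upper (24 * y)`, and there are finitely many residues modulo 24. The
torus is the centralizer of one generic element. Conjugation by `torus a` multiplies a root by `a ^
2`, and (y+1)² - (y-1)² + (z+1)² - (z-1)² = 4(y+z) = 24x when y + z = 6x. So every ring element is
one of finitely many constants plus an alternating sum of four squares of units, and this makes
multiplication definable (`definable_mulGraph`). Passing to `G` loses no centralizers, by a trace
argument (`eq_of_map_mul_comm`).

The composite on `A` is definable since it only asks whether two matrices agree modulo the kernel.
For the composite on `G`, stable rank one writes every matrix as a product of four elementary ones,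
so an element can be recovered in the group language from the roots of its entries.

Finally, `UnitRich` is checked in local rings and passed to products componentwise; for adeles the
local choices are made integrally at almost all places. The arithmetic input is that only finitely
many places divide 24, with finite residue rings there. -/

theorem definable_congr {S T : Set (α → M)} (hT : (Set.univ : Set M).Definable L T)
    (h : ∀ v, v ∈ S ↔ v ∈ T) : (Set.univ : Set M).Definable L S :=
  Set.ext h ▸ hT

theorem definable_and {P Q : (α → M) → Prop}
    (hP : (Set.univ : Set M).Definable L {v | P v})
    (hQ : (Set.univ : Set M).Definable L {v | Q v}) :
    (Set.univ : Set M).Definable L {v | P v ∧ Q v} :=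
  hP.inter hQ

theorem definable_or {P Q : (α → M) → Prop}
    (hP : (Set.univ : Set M).Definable L {v | P v})
    (hQ : (Set.univ : Set M).Definable L {v | Q v}) :
    (Set.univ : Set M).Definable L {v | P v ∨ Q v} :=
  hP.union hQ

theorem definable_forall_finite {ι : Type*} [Finite ι] {P : ι → (α → M) → Prop}
    (hP : ∀ i, (Set.univ : Set M).Definable L {v | P i v}) :
    (Set.univ : Set M).Definable L {v | ∀ i, P i v} := by
  convert Set.definable_iInter_of_finite hP using 1
  ext v
  simp

theorem definable_exists_finite {ι : Type*} [Finite ι] {P : ι → (α → M) → Prop}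
    (hP : ∀ i, (Set.univ : Set M).Definable L {v | P i v}) :
    (Set.univ : Set M).Definable L {v | ∃ i, P i v} := by
  convert Set.definable_iUnion_of_finite hP using 1
  ext v
  simp

theorem definable_exists_tuple [Finite β] {P : (α → M) → (β → M) → Prop}
    (hP : (Set.univ : Set M).Definable L
      {w : α ⊕ β → M | P (fun i => w (.inl i)) (fun i => w (.inr i))}) :
    (Set.univ : Set M).Definable L {v | ∃ u, P v u} :=
  Set.Definable.exists_of_finite hP

theorem definable_exists {P : (α → M) → M → Prop}
    (hP : (Set.univ : Set M).Definable L
      {w : α ⊕ Fin 1 → M | P (fun i => w (.inl i)) (w (.inr 0))}) :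
    (Set.univ : Set M).Definable L {v | ∃ u, P v u} := by
  convert definable_exists_tuple (P := fun v (u : Fin 1 → M) => P v (u 0)) hP using 1
  ext v
  exact ⟨fun ⟨u, hu⟩ => ⟨fun _ => u, hu⟩, fun ⟨u, hu⟩ => ⟨u 0, hu⟩⟩

theorem definableFun_const_univ (a : M) :
    (Set.univ : Set M).DefinableFun L (fun _ : α → M => a) :=
  L.definableFun_const α (Set.mem_univ a)

theorem definableFun_funMap {n : ℕ} (F : L.Functions n) {t : Fin n → (α → M) → M}
    (ht : ∀ i, (Set.univ : Set M).DefinableFun L (t i)) :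
    (Set.univ : Set M).DefinableFun L (fun v => Structure.funMap F (fun i => t i v)) :=
  Set.DefinableFun.comp (g := fun v i => t i v) ht
    (Set.DefinableFun.of_empty (Set.DefinableFun.fun_symbol F))

theorem definable_preimage {S : Set (β → M)} [Finite β] (hS : (Set.univ : Set M).Definable L S)
    {t : β → (α → M) → M} (ht : ∀ i, (Set.univ : Set M).DefinableFun L (t i)) :
    (Set.univ : Set M).Definable L {v | (fun i => t i v) ∈ S} :=
  hS.preimage_map (F := fun v i => t i v) ht

theorem definable_mem {S : Set M} (hS : (Set.univ : Set M).Definable₁ L S)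
    {t : (α → M) → M} (ht : (Set.univ : Set M).DefinableFun L t) :
    (Set.univ : Set M).Definable L {v | t v ∈ S} :=
  definable_preimage (S := {x : Fin 1 → M | x 0 ∈ S}) hS (t := fun _ => t) fun _ => ht

end Kit

/-! ### Definable functions of groups and rings -/

section Group

attribute [local instance] gpStructure

variable {G : Type*} [Group G] {α : Type*} {s t : (α → G) → G}

theorem definableFun_group_mul (hs : (Set.univ : Set G).DefinableFun gp s)
    (ht : (Set.univ : Set G).DefinableFun gp t) :
    (Set.univ : Set G).DefinableFun gp (fun v => s v * t v) :=
  definableFun_funMap (L := gp) GroupFunc.mul (t := ![s, t]) (by simp [Fin.forall_fin_two, hs, ht])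

theorem definableFun_group_inv (hs : (Set.univ : Set G).DefinableFun gp s) :
    (Set.univ : Set G).DefinableFun gp (fun v => (s v)⁻¹) :=
  definableFun_funMap (L := gp) GroupFunc.inv (t := fun _ => s) fun _ => hs

end Group

section Ring

attribute [local instance] Ring.compatibleRingOfRing

variable {A : Type*} [CommRing A] {α : Type*} {s t : (α → A) → A}

theorem definableFun_ring_mul (hs : (Set.univ : Set A).DefinableFun ring s)
    (ht : (Set.univ : Set A).DefinableFun ring t) :
    (Set.univ : Set A).DefinableFun ring (fun v => s v * t v) :=
  definableFun_funMap (L := ring) Ring.mulFunc (t := ![s, t])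
    (by simp [Fin.forall_fin_two, hs, ht])

theorem definableFun_ring_add (hs : (Set.univ : Set A).DefinableFun ring s)
    (ht : (Set.univ : Set A).DefinableFun ring t) :
    (Set.univ : Set A).DefinableFun ring (fun v => s v + t v) :=
  definableFun_funMap (L := ring) Ring.addFunc (t := ![s, t])
    (by simp [Fin.forall_fin_two, hs, ht])

theorem definableFun_ring_neg (hs : (Set.univ : Set A).DefinableFun ring s) :
    (Set.univ : Set A).DefinableFun ring (fun v => -s v) :=
  definableFun_funMap (L := ring) Ring.negFunc (t := fun _ => s) fun _ => hs

theorem definableFun_ring_sub (hs : (Set.univ : Set A).DefinableFun ring s)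
    (ht : (Set.univ : Set A).DefinableFun ring t) :
    (Set.univ : Set A).DefinableFun ring (fun v => s v - t v) := by
  simpa only [sub_eq_add_neg] using definableFun_ring_add hs (definableFun_ring_neg ht)

end Ring

end FirstOrder.Language

/-! ### Elementary matrices and tori in `SL₂` -/

namespace SpecialLinearTwo

open Matrix

/-- The group `SL₂(A)`. -/
abbrev SL₂ (A : Type*) [CommRing A] := Matrix.SpecialLinearGroup (Fin 2) A

/-- The ring of `2 × 2` matrices. -/
abbrev M₂ (A : Type*) := Matrix (Fin 2) (Fin 2) A

variable {A : Type*} [CommRing A]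

/-- The upper unitriangular matrix with entry `x`. -/
def upper (x : A) : SL₂ A := ⟨!![1, x; 0, 1], by simp⟩

/-- The Weyl element. -/
def weyl : SL₂ A := ⟨!![0, -1; 1, 0], by simp⟩

/-- The diagonal matrix with entries `a` and `a⁻¹`. -/
def torus (a : Aˣ) : SL₂ A := ⟨!![(a : A), 0; 0, ((a⁻¹ : Aˣ) : A)], by simp⟩

/-- The matrix with the given entries, listed by rows. -/
def ofEntries (v : Fin 4 → A) : M₂ A := !![v 0, v 1; v 2, v 3]

@[simp] theorem det_ofEntries (v : Fin 4 → A) :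
    (ofEntries v).det = v 0 * v 3 - v 1 * v 2 := by
  simp [ofEntries, det_fin_two]

@[simp] theorem coe_upper (x : A) : (upper x : M₂ A) = !![1, x; 0, 1] := rfl

@[simp] theorem coe_weyl : ((weyl : SL₂ A) : M₂ A) = !![0, -1; 1, 0] := rfl

@[simp] theorem coe_torus (a : Aˣ) :
    (torus a : M₂ A) = !![(a : A), 0; 0, ((a⁻¹ : Aˣ) : A)] := rfl

theorem exists_ofEntries (g : SL₂ A) : ∃ v : Fin 4 → A, (g : M₂ A) = ofEntries v :=
  ⟨![g.1 0 0, g.1 0 1, g.1 1 0, g.1 1 1], by simpa [ofEntries] using eta_fin_two g.1⟩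

theorem upper_mul (x y : A) : upper x * upper y = upper (x + y) := by
  apply Subtype.ext
  simp [Matrix.SpecialLinearGroup.coe_mul, add_comm]

theorem upper_zero : upper (0 : A) = 1 := by
  apply Subtype.ext
  simp [one_fin_two]

theorem upper_inv (x : A) : (upper x)⁻¹ = upper (-x) :=
  inv_eq_of_mul_eq_one_right (by rw [upper_mul, add_neg_cancel, upper_zero])

theorem torus_conj (a : Aˣ) (x : A) : torus a * upper x * (torus a)⁻¹ = upper (a ^ 2 * x) := by
  rw [mul_inv_eq_iff_eq_mul]
  apply Subtype.ext
  simp only [Matrix.SpecialLinearGroup.coe_mul, coe_torus, coe_upper]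
  ext i j
  fin_cases i <;> fin_cases j <;> simp
  linear_combination (-(a : A) * x) * a.mul_inv

/-- A matrix commuting with `upper 1` has the form (a, b; 0, a) with a² = 1. Squaring removes the
sign-like factor a and leaves the root 2ab. -/
theorem exists_sq_eq_upper {g : SL₂ A} (h : g * upper 1 = upper 1 * g) :
    ∃ x, g * g = upper (2 * x) := by
  obtain ⟨v, hv⟩ := exists_ofEntries g
  have hdet := g.2
  rw [hv, det_ofEntries] at hdet
  have h' := congrArg (fun x : SL₂ A => (x : M₂ A)) h
  simp only [Matrix.SpecialLinearGroup.coe_mul, hv, coe_upper] at h'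
  have h00 := congrFun₂ h' 0 0
  have h01 := congrFun₂ h' 0 1
  simp [ofEntries] at h00 h01
  refine ⟨v 0 * v 1, Subtype.ext ?_⟩
  simp only [Matrix.SpecialLinearGroup.coe_mul, hv, coe_upper]
  have h3 : v 3 = v 0 := by linear_combination -h01
  rw [h00, h3] at hdet
  ext i j
  fin_cases i <;> fin_cases j <;> simp [ofEntries, h00, h3]
  · linear_combination hdet
  · ring
  · linear_combination hdet

/-- Commutation makes `a ^ 2 - 1` annihilate both off-diagonal entries. -/
theorem exists_eq_torus {a : Aˣ} (ha : ∀ x : A, ((a : A) ^ 2 - 1) * x = 0 → x = 0) {g : SL₂ A}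
    (h : g * torus a = torus a * g) : ∃ b, g = torus b := by
  obtain ⟨v, hv⟩ := exists_ofEntries g
  have hdet := g.2
  rw [hv, det_ofEntries] at hdet
  have h' := congrArg (fun x : SL₂ A => (x : M₂ A)) h
  simp only [Matrix.SpecialLinearGroup.coe_mul, hv, coe_torus] at h'
  have h01 := congrFun₂ h' 0 1
  have h10 := congrFun₂ h' 1 0
  simp [ofEntries] at h01 h10
  have hi := a.mul_inv
  have h1 : v 1 = 0 := ha _ (by linear_combination -(a : A) * h01 + v 1 * hi)
  have h2 : v 2 = 0 := ha _ (by linear_combination (a : A) * h10 + v 2 * hi)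
  rw [h1, zero_mul, sub_zero] at hdet
  refine ⟨⟨v 0, v 3, hdet, by rw [mul_comm, hdet]⟩, Subtype.ext ?_⟩
  rw [hv]
  simp [ofEntries, h1, h2]

theorem torus_mul_comm (a b : Aˣ) : torus a * torus b = torus b * torus a := by
  apply Subtype.ext
  simp [Matrix.SpecialLinearGroup.coe_mul, mul_comm]

/-- The product of four elementary matrices. -/
theorem coe_elementary_mul (p q r s : A) :
    (((weyl * (upper p)⁻¹ * weyl⁻¹) * upper q * (weyl * (upper r)⁻¹ * weyl⁻¹) * upper s :
      SL₂ A) : M₂ A) =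
      !![1 + q * r, q + s * (1 + q * r);
         r + p * (1 + q * r), 1 + r * s + p * (q + s * (1 + q * r))] := by
  have hw : (((weyl : SL₂ A)⁻¹ : SL₂ A) : M₂ A) = !![0, 1; -1, 0] := by
    rw [Matrix.SpecialLinearGroup.coe_inv, coe_weyl, adjugate_fin_two_of]
    simp
  simp only [Matrix.SpecialLinearGroup.coe_mul, upper_inv, hw, coe_weyl, coe_upper]
  ext i j
  fin_cases i <;> fin_cases j <;> simp <;> ring

/-- Over a ring of stable rank one, every element of `SL₂` is the product of four elementary
matrices. -/
theorem exists_entries_eq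
    (hA : ∀ a c : A, IsCoprime a c → ∃ s, IsUnit (c + s * a)) {v : Fin 4 → A}
    (hv : v 0 * v 3 - v 1 * v 2 = 1) :
    ∃ p q r s, v 0 = 1 + q * r ∧ v 1 = q + s * v 0 ∧ v 2 = r + p * v 0 ∧
      v 3 = 1 + r * s + p * v 1 := by
  -- The first column is unimodular. Adding t times the first row to the second makes the lower left
  -- entry a unit e, and division by e then determines the other factors.
  obtain ⟨t, e, he⟩ := hA (v 0) (v 2) ⟨v 3, -v 1, by linear_combination hv⟩
  have hi := e.mul_inv
  set f : A := ((e⁻¹ : Aˣ) : A)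
  have h0 : v 0 = 1 + (v 0 - 1) * f * e := by linear_combination (1 - v 0) * hi
  have hd : v 0 * (v 3 + t * v 1) - v 1 * e = 1 := by rw [he]; linear_combination hv
  refine ⟨-t, (v 0 - 1) * f, e, f * (v 3 + t * v 1 - 1), h0, ?_, ?_, ?_⟩
  · linear_combination (-f) * hd - v 1 * hi
  · linear_combination -he
  · linear_combination (1 - (v 3 + t * v 1)) * hi

/-- If g and h commute modulo the centre, then g h g⁻¹ = r h for a scalar r. Comparing traces gives
(r - 1) tr h = 0, so r = 1 when tr h is not a zero divisor. -/
theorem eq_of_map_mul_comm {G : Type*} [Group G] {π : SL₂ A →* G}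
    (hker : π.ker ≤ Subgroup.center (SL₂ A)) {g h : SL₂ A}
    (htr : ∀ x, (h : M₂ A).trace * x = 0 → x = 0) (hc : π g * π h = π h * π g) : g * h = h * g := by
  have hz : g * h * g⁻¹ * h⁻¹ ∈ π.ker := by
    rw [MonoidHom.mem_ker]
    simp [hc]
  obtain ⟨r, -, hr⟩ := Matrix.SpecialLinearGroup.mem_center_iff.1 (hker hz)
  have hgh : g * h * g⁻¹ = (g * h * g⁻¹ * h⁻¹) * h := by group
  have ht := congrArg (fun x : SL₂ A => (x : M₂ A).trace) hgh
  simp only [Matrix.SpecialLinearGroup.coe_mul] at ht hr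
  rw [← hr, trace_mul_cycle, ← Matrix.SpecialLinearGroup.coe_mul, inv_mul_cancel,
    Matrix.SpecialLinearGroup.coe_one, one_mul, scalar_apply, ← smul_eq_diagonal_mul, trace_smul,
    smul_eq_mul] at ht
  have hr1 : r = 1 := by
    have := htr (r - 1) (by linear_combination -ht)
    linear_combination this
  rw [hr1, map_one] at hr
  have h1 : g * h * g⁻¹ * h⁻¹ = 1 := Subtype.ext (by simpa using hr.symm)
  rwa [mul_inv_eq_one, mul_inv_eq_iff_eq_mul] at h1

/-- A unitriangular matrix in the kernel is scalar, so its off-diagonal entry vanishes. -/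
theorem eq_of_map_upper_eq {G : Type*} [Group G] {π : SL₂ A →* G}
    (hker : π.ker ≤ Subgroup.center (SL₂ A)) {x y : A} (h : π (upper x) = π (upper y)) :
    x = y := by
  have hz : upper (x - y) ∈ π.ker := by
    rw [MonoidHom.mem_ker, sub_eq_add_neg, ← upper_mul, ← upper_inv, map_mul, h, ← map_mul,
      mul_inv_cancel, map_one]
  obtain ⟨r, -, hr⟩ := Matrix.SpecialLinearGroup.mem_center_iff.1 (hker hz)
  have := congrFun₂ hr 0 1
  simp at this
  exact (sub_eq_zero.1 this.symm)

end SpecialLinearTwo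

/-! ### Rings over which `SL₂` is bi-interpretable with the ring -/

namespace SpecialLinearTwo

open Matrix

/-- Conditions on a ring `A` under which `SL₂(A)` determines `A`: it has no `2`-torsion, a
sufficiently generic unit, only finitely many residues modulo `24`, stable rank one, and every
multiple of `6` is the sum of two elements `y`, `z` for which `y ± 1` and `z ± 1` are units. -/
structure UnitRich (A : Type*) [CommRing A] : Prop where
  two_mul_eq_zero : ∀ x : A, 2 * x = 0 → x = 0
  exists_unit : ∃ a : Aˣ, (∀ x : A, ((a : A) ^ 2 - 1) * x = 0 → x = 0) ∧
    ∀ x : A, ((a : A) ^ 2 + 1) * x = 0 → x = 0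
  finite_residues : ∃ F : Finset A, ∀ x : A, ∃ c ∈ F, ∃ y, x = c + 24 * y
  exists_add_eq : ∀ x : A, ∃ y z : A, y + z = 6 * x ∧
    (IsUnit (y + 1) ∧ IsUnit (y - 1)) ∧ IsUnit (z + 1) ∧ IsUnit (z - 1)
  stable_rank : ∀ a c : A, IsCoprime a c → ∃ s, IsUnit (c + s * a)

/-- The alternating sum of the squares of four units. -/
def altSum {A : Type*} [CommRing A] (a : Fin 4 → Aˣ) : A :=
  (a 0 : A) ^ 2 - (a 1 : A) ^ 2 + (a 2 : A) ^ 2 - (a 3 : A) ^ 2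

/-- With y + z = 6t, the units y ± 1 and z ± 1 have alternating sum of squares 4(y + z) = 24t; the
finitely many residues modulo 24 account for c. -/
theorem UnitRich.exists_altSum {A : Type*} [CommRing A] (hA : UnitRich A) :
    ∃ F : Finset A, ∀ x : A, ∃ c ∈ F, ∃ a : Fin 4 → Aˣ, x = c + altSum a := by
  obtain ⟨F, hF⟩ := hA.finite_residues
  refine ⟨F, fun x => ?_⟩
  obtain ⟨c, hc, t, rfl⟩ := hF x
  obtain ⟨y, z, hyz, ⟨⟨a, ha⟩, ⟨b, hb⟩⟩, ⟨d, hd⟩, ⟨e, he⟩⟩ := hA.exists_add_eq t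
  refine ⟨c, hc, ![a, b, d, e], ?_⟩
  simp only [altSum, cons_val, ha, hb, hd, he]
  linear_combination (-4) * hyz

/-- A homomorphism from `SL₂(A)` onto `G` whose kernel is central and definable in `A`. -/
structure DefinableCentralQuotient {A : Type*} [CommRing A] {G : Type*} [Group G]
    (π : SL₂ A →* G) : Prop where
  surjective : Function.Surjective π
  ker_le : π.ker ≤ Subgroup.center (SL₂ A)
  definable_ker : letI := Ring.compatibleRingOfRing A
    (Set.univ : Set A).Definable Language.ring
      {v : Fin 4 → A | ∃ g ∈ π.ker, (g : M₂ A) = ofEntries v}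

/-! ### Definability of the root group, the torus and multiplication in the group -/

section

attribute [local instance] Language.gpStructure Ring.compatibleRingOfRing

open Language

variable {A : Type*} [CommRing A] {G : Type*} [Group G] {π : SL₂ A →* G}

/-- The image of an upper unitriangular matrix. -/
def root (π : SL₂ A →* G) (x : A) : G := π (upper x)

theorem root_add (x y : A) : root π (x + y) = root π x * root π y := by
  rw [root, root, root, ← map_mul, upper_mul]

theorem root_neg (x : A) : root π (-x) = (root π x)⁻¹ := by
  rw [root, root, ← map_inv, upper_inv]

variable (hA : UnitRich A) (hπ : DefinableCentralQuotient π)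

include hA hπ in
-- The root group is a finite union of translates of the set of squares in the centralizer of `root
-- π 1`.
theorem definable_root_group :
    (Set.univ : Set G).Definable₁ gp {X | ∃ x, X = root π x} := by
  obtain ⟨F, hF⟩ := hA.finite_residues
  have h : {X : G | ∃ x, X = root π x} = {X | ∃ c : F, ∃ Y,
      Y * root π 1 = root π 1 * Y ∧ X = root π (c : A) * (Y * Y)} := by
    ext X
    constructor
    · rintro ⟨x, rfl⟩
      obtain ⟨c, hc, y, rfl⟩ := hF x
      -- The square of this element is the root of 24y.
      refine ⟨⟨c, hc⟩, root π (12 * y), ?_, ?_⟩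
      · rw [← root_add, ← root_add, add_comm]
      · rw [← root_add, ← root_add]
        congr 1
        ring
    · rintro ⟨c, Y, hY, rfl⟩
      obtain ⟨g, rfl⟩ := hπ.surjective Y
      have hg := eq_of_map_mul_comm hπ.ker_le (h := upper 1) (fun x hx => hA.two_mul_eq_zero x (by
        rw [← hx]; simp [trace_fin_two_of, one_add_one_eq_two])) hY
      obtain ⟨x, hx⟩ := exists_sq_eq_upper hg
      exact ⟨c + 2 * x, by rw [root_add, ← map_mul, hx]; rfl⟩
  rw [h]
  refine definable_exists_finite fun c => definable_exists (definable_and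
    (Set.DefinableFun.ofPred_eq ?_ ?_) (Set.DefinableFun.ofPred_eq ?_ ?_))
  · exact definableFun_group_mul (.proj _) (definableFun_const_univ _)
  · exact definableFun_group_mul (definableFun_const_univ _) (.proj _)
  · exact .proj _
  · exact definableFun_group_mul (definableFun_const_univ _)
      (definableFun_group_mul (.proj _) (.proj _))

include hA hπ in
theorem definable_torus :
    (Set.univ : Set G).Definable₁ gp {X | ∃ a : Aˣ, X = π (torus a)} := by
  obtain ⟨a, ha, ha'⟩ := hA.exists_unit
  have h : {X : G | ∃ b, X = π (torus b)} = {X | X * π (torus a) = π (torus a) * X} := by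
    ext X
    constructor
    · rintro ⟨b, rfl⟩
      simp only [Set.mem_ofPred_eq, ← map_mul, torus_mul_comm]
    · intro hX
      obtain ⟨g, rfl⟩ := hπ.surjective X
      -- The trace a + a⁻¹ is a unit times a² + 1; this is where the second condition on the generic
      -- unit enters.
      have hg := eq_of_map_mul_comm hπ.ker_le (h := torus a) (fun x hx => ha' x (by
        simp only [coe_torus, trace_fin_two_of] at hx
        linear_combination (a : A) * hx - x * a.mul_inv)) hX
      obtain ⟨b, hb⟩ := exists_eq_torus ha hg
      exact ⟨b, by rw [hb]⟩
  rw [h]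
  refine Set.DefinableFun.ofPred_eq ?_ ?_
  · exact definableFun_group_mul (.proj _) (definableFun_const_univ _)
  · exact definableFun_group_mul (definableFun_const_univ _) (.proj _)

/-- The alternating product of four conjugates of `Y`. -/
def altConj (h : Fin 4 → G) (Y : G) : G :=
  h 0 * Y * (h 0)⁻¹ * (h 1 * Y * (h 1)⁻¹)⁻¹ * (h 2 * Y * (h 2)⁻¹) * (h 3 * Y * (h 3)⁻¹)⁻¹

theorem altConj_root (a : Fin 4 → Aˣ) (y : A) :
    altConj (fun i => π (torus (a i))) (root π y) = root π (altSum a * y) := by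
  have h : ∀ b : Aˣ, π (torus b) * root π y * (π (torus b))⁻¹ = root π ((b : A) ^ 2 * y) := by
    intro b
    rw [root, root, ← torus_conj, map_mul, map_mul, map_inv]
  simp only [altConj, h, ← root_neg, ← root_add, altSum]
  congr 1
  ring

theorem definableFun_altConj {α : Type*} {h : Fin 4 → (α → G) → G} {t : (α → G) → G}
    (hh : ∀ i, (Set.univ : Set G).DefinableFun gp (h i))
    (ht : (Set.univ : Set G).DefinableFun gp t) :
    (Set.univ : Set G).DefinableFun gp (fun v => altConj (fun i => h i v) (t v)) := by
  have hc : ∀ i, (Set.univ : Set G).DefinableFun gp (fun v => h i v * t v * (h i v)⁻¹) :=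
    fun i => definableFun_group_mul (definableFun_group_mul (hh i) ht)
      (definableFun_group_inv (hh i))
  exact definableFun_group_mul (definableFun_group_mul (definableFun_group_mul (hc 0)
    (definableFun_group_inv (hc 1))) (hc 2)) (definableFun_group_inv (hc 3))

/-- The graph of multiplication, transported to the root group. -/
def mulGraph (π : SL₂ A →* G) : Set (Fin 3 → G) :=
  {v | ∃ x y, v 0 = root π x ∧ v 1 = root π y ∧ v 2 = root π (x * y)}

include hA hπ in
-- For x = c + `altSum a` and y = d + `altSum b`, the product is `altSum a` · y + `altSum b` · c + c
-- d. Each summand is a constant or an alternating product of torus conjugates of a known root.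
theorem definable_mulGraph : (Set.univ : Set G).Definable gp (mulGraph π) := by
  obtain ⟨F, hF⟩ := hA.exists_altSum
  have h : mulGraph π = {v | (∃ y, v 1 = root π y) ∧ ∃ c d : F, ∃ h k : Fin 4 → G,
      (∀ i, ∃ a : Aˣ, h i = π (torus a)) ∧ (∀ i, ∃ a : Aˣ, k i = π (torus a)) ∧
      v 0 = root π (c : A) * altConj h (root π 1) ∧
      v 1 = root π (d : A) * altConj k (root π 1) ∧
      v 2 = altConj h (v 1) * (altConj k (root π (c : A)) * root π (c * d : A))} := by
    ext v
    constructor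
    · rintro ⟨x, y, h0, h1, h2⟩
      obtain ⟨c, hc, a, rfl⟩ := hF x
      obtain ⟨d, hd, b, rfl⟩ := hF y
      refine ⟨⟨_, h1⟩, ⟨c, hc⟩, ⟨d, hd⟩, fun i => π (torus (a i)), fun i => π (torus (b i)),
        fun i => ⟨_, rfl⟩, fun i => ⟨_, rfl⟩, ?_, ?_, ?_⟩
      · rw [h0, altConj_root, ← root_add, mul_one]
      · rw [h1, altConj_root, ← root_add, mul_one]
      · rw [h1, h2, altConj_root, altConj_root, ← root_add, ← root_add]
        congr 1
        ring
    · rintro ⟨-, c, d, h, k, hh, hk, h0, h1, h2⟩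
      choose a ha using hh
      choose b hb using hk
      obtain rfl := funext ha
      obtain rfl := funext hb
      rw [altConj_root, ← root_add, mul_one] at h0 h1
      refine ⟨_, _, h0, h1, ?_⟩
      rw [h2, h1, altConj_root, altConj_root, ← root_add, ← root_add]
      congr 1
      ring
  have hU := definable_root_group hA hπ
  have hT := definable_torus hA hπ
  rw [h]
  refine definable_and (definable_mem hU (.proj _)) (definable_exists_finite fun c =>
    definable_exists_finite fun d => definable_exists_tuple (definable_exists_tuple ?_))
  refine definable_and (definable_forall_finite fun i => definable_mem hT (.proj _))
    (definable_and (definable_forall_finite fun i => definable_mem hT (.proj _))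
    (definable_and (Set.DefinableFun.ofPred_eq ?_ ?_)
    (definable_and (Set.DefinableFun.ofPred_eq ?_ ?_) (Set.DefinableFun.ofPred_eq ?_ ?_))))
  · exact .proj _
  · exact definableFun_group_mul (definableFun_const_univ _)
      (definableFun_altConj (fun i => .proj _) (definableFun_const_univ _))
  · exact .proj _
  · exact definableFun_group_mul (definableFun_const_univ _)
      (definableFun_altConj (fun i => .proj _) (definableFun_const_univ _))
  · exact .proj _
  · exact definableFun_group_mul (definableFun_altConj (fun i => .proj _) (.proj _))
      (definableFun_group_mul
        (definableFun_altConj (fun i => .proj _) (definableFun_const_univ _))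
        (definableFun_const_univ _))

end

end SpecialLinearTwo

/-! ### The two interpretations -/

namespace SpecialLinearTwo

open Matrix Language

attribute [local instance] Language.gpStructure Ring.compatibleRingOfRing

variable {A : Type*} [CommRing A] {G : Type*} [Group G] {π : SL₂ A →* G}

/-- The element of `SL₂(A)` with the given entries. -/
def mk (v : Fin 4 → A) (hv : v 0 * v 3 - v 1 * v 2 = 1) : SL₂ A :=
  ⟨ofEntries v, by rw [det_ofEntries, hv]⟩

/-- A matrix of functions, all of them definable. -/
def DefinableMatrix {α : Type*} (m : (α → A) → M₂ A) : Prop :=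
  ∀ i j, (Set.univ : Set A).DefinableFun Language.ring (fun v => m v i j)

theorem DefinableMatrix.mul {α : Type*} {m n : (α → A) → M₂ A} (hm : DefinableMatrix m)
    (hn : DefinableMatrix n) : DefinableMatrix (fun v => m v * n v) := by
  intro i j
  simp only [mul_apply, Fin.sum_univ_two]
  exact definableFun_ring_add (definableFun_ring_mul (hm i 0) (hn 0 j))
    (definableFun_ring_mul (hm i 1) (hn 1 j))

theorem DefinableMatrix.ofEntries {α : Type*} {t : Fin 4 → (α → A) → A}
    (ht : ∀ i, (Set.univ : Set A).DefinableFun Language.ring (t i)) :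
    DefinableMatrix (fun v => ofEntries (fun i => t i v)) := by
  intro i j
  fin_cases i <;> fin_cases j
  exacts [ht 0, ht 1, ht 2, ht 3]

theorem DefinableMatrix.definable_eq {α : Type*} {m n : (α → A) → M₂ A} (hm : DefinableMatrix m)
    (hn : DefinableMatrix n) :
    (Set.univ : Set A).Definable Language.ring {v | m v = n v} := by
  simp only [← Matrix.ext_iff]
  exact definable_forall_finite fun i => definable_forall_finite fun j =>
    Set.DefinableFun.ofPred_eq (hm i j) (hn i j)

theorem DefinableMatrix.const {α : Type*} (m : M₂ A) :
    DefinableMatrix (fun _ : α → A => m) :=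
  fun _ _ => definableFun_const_univ _

theorem DefinableMatrix.upper {α : Type*} {t : (α → A) → A}
    (ht : (Set.univ : Set A).DefinableFun Language.ring t) :
    DefinableMatrix (fun v => (upper (t v) : M₂ A)) := by
  intro i j
  fin_cases i <;> fin_cases j
  exacts [definableFun_const_univ _, ht, definableFun_const_univ _, definableFun_const_univ _]

theorem definable_det {α : Type*} {t : Fin 4 → (α → A) → A}
    (ht : ∀ i, (Set.univ : Set A).DefinableFun Language.ring (t i)) :
    (Set.univ : Set A).Definable Language.ring
      {v | t 0 v * t 3 v - t 1 v * t 2 v = 1} :=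
  Set.DefinableFun.ofPred_eq
    (definableFun_ring_sub (definableFun_ring_mul (ht 0) (ht 3))
      (definableFun_ring_mul (ht 1) (ht 2))) (definableFun_const_univ _)

/-- The kernel element is kept as a quadruple of entries so that `definable_ker` applies to the
right-hand side. -/
theorem map_eq_map_iff (g h : SL₂ A) :
    π g = π h ↔ ∃ k : Fin 4 → A, (∃ c ∈ π.ker, (c : M₂ A) = ofEntries k) ∧
      (g : M₂ A) = h * ofEntries k := by
  constructor
  · intro e
    obtain ⟨k, hk⟩ := exists_ofEntries (h⁻¹ * g)
    refine ⟨k, ⟨_, ?_, hk⟩, ?_⟩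
    · rw [MonoidHom.mem_ker, map_mul, map_inv, e, inv_mul_cancel]
    · rw [← hk, ← Matrix.SpecialLinearGroup.coe_mul, mul_inv_cancel_left]
  · rintro ⟨k, ⟨c, hc, hk⟩, e⟩
    rw [← hk, ← Matrix.SpecialLinearGroup.coe_mul] at e
    have e' : g = h * c := Subtype.ext e
    rw [e', map_mul, MonoidHom.mem_ker.1 hc, mul_one]

theorem map_mk_mul_eq_iff {x y w : Fin 4 → A} (hx : x 0 * x 3 - x 1 * x 2 = 1)
    (hy : y 0 * y 3 - y 1 * y 2 = 1) (hw : w 0 * w 3 - w 1 * w 2 = 1) :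
    π (mk x hx) * π (mk y hy) = π (mk w hw) ↔
      ∃ k : Fin 4 → A, (∃ c ∈ π.ker, (c : M₂ A) = ofEntries k) ∧
        ofEntries x * ofEntries y = ofEntries w * ofEntries k := by
  rw [← map_mul, map_eq_map_iff]
  rfl

theorem inv_map_mk_eq_iff {x y : Fin 4 → A} (hx : x 0 * x 3 - x 1 * x 2 = 1)
    (hy : y 0 * y 3 - y 1 * y 2 = 1) :
    (π (mk x hx))⁻¹ = π (mk y hy) ↔
      ∃ k : Fin 4 → A, (∃ c ∈ π.ker, (c : M₂ A) = ofEntries k) ∧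
        1 = ofEntries x * ofEntries y * ofEntries k := by
  rw [inv_eq_iff_mul_eq_one, eq_comm, ← map_mul, ← map_one π, map_eq_map_iff,
    Matrix.SpecialLinearGroup.coe_one]
  rfl

theorem one_eq_map_mk_iff {x : Fin 4 → A} (hx : x 0 * x 3 - x 1 * x 2 = 1) :
    1 = π (mk x hx) ↔
      ∃ k : Fin 4 → A, (∃ c ∈ π.ker, (c : M₂ A) = ofEntries k) ∧
        1 = ofEntries x * ofEntries k := by
  rw [← map_one π, map_eq_map_iff, Matrix.SpecialLinearGroup.coe_one]
  rfl

/-- Equality in the quotient of two definable matrices is definable. -/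
theorem DefinableCentralQuotient.definable_eq (hπ : DefinableCentralQuotient π) {α : Type*}
    [Finite α] {m n : (α → A) → M₂ A} (hm : DefinableMatrix m) (hn : DefinableMatrix n) :
    (Set.univ : Set A).Definable Language.ring
      {v | ∃ k : Fin 4 → A, (∃ c ∈ π.ker, (c : M₂ A) = SpecialLinearTwo.ofEntries k) ∧
        m v = n v * SpecialLinearTwo.ofEntries k} := by
  refine definable_exists_tuple (definable_and ?_ ?_)
  · exact definable_preimage hπ.definable_ker fun i => .proj _
  · refine DefinableMatrix.definable_eq ?_ (DefinableMatrix.mul ?_ ?_)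
    · exact fun i j => Set.DefinableFun.comp (g := fun w i => w (Sum.inl i)) (fun _ => .proj _)
        (hm i j)
    · exact fun i j => Set.DefinableFun.comp (g := fun w i => w (Sum.inl i)) (fun _ => .proj _)
        (hn i j)
    · exact .ofEntries fun _ => .proj _

/-- The interpretation of a quotient of `SL₂(A)` in `A` by the entries of matrices. -/
def groupInterpretation (hπ : DefinableCentralQuotient π) :
    Interpretation Language.ring A gp G where
  dim := 4
  dom := {v | v 0 * v 3 - v 1 * v 2 = 1}
  map v := π (mk v.1 v.2)
  surjective X := by
    obtain ⟨g, rfl⟩ := hπ.surjective X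
    obtain ⟨v, hv⟩ := exists_ofEntries g
    exact ⟨⟨v, by rw [Set.mem_ofPred_eq, ← det_ofEntries, ← hv, g.2]⟩,
      congrArg π (Subtype.ext hv.symm)⟩
  definable_dom := definable_det (t := fun i v => v i) fun _ => .proj _
  definable_eq := by
    convert definable_and (definable_forall_finite fun i : Fin 2 => definable_det
      (t := fun j z => z (i, j)) fun _ => .proj _)
      (hπ.definable_eq (m := fun z : Fin 2 × Fin 4 → A => ofEntries fun j => z (0, j))
        (n := fun z => ofEntries fun j => z (1, j))
        (.ofEntries fun _ => .proj _) (.ofEntries fun _ => .proj _)) using 1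
    ext z
    simp only [pullback, Set.mem_ofPred_eq]
    rw [← exists_prop]
    exact exists_congr fun h => map_eq_map_iff _ _
  definable_fun k F := by
    cases F with
    | mul =>
      convert definable_and (definable_forall_finite fun i : Fin 3 => definable_det
        (t := fun j z => z (i, j)) fun _ => .proj _)
        (hπ.definable_eq (m := fun z : Fin 3 × Fin 4 → A =>
            ofEntries (fun j => z (0, j)) * ofEntries (fun j => z (1, j)))
          (n := fun z => ofEntries fun j => z (2, j))
          (.mul (.ofEntries fun _ => .proj _) (.ofEntries fun _ => .proj _))
          (.ofEntries fun _ => .proj _)) using 1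
      ext z
      simp only [pullback, Set.mem_ofPred_eq]
      rw [← exists_prop]
      exact exists_congr fun h => map_mk_mul_eq_iff (h 0) (h 1) (h 2)
    | inv =>
      convert definable_and (definable_forall_finite fun i : Fin 2 => definable_det
        (t := fun j z => z (i, j)) fun _ => .proj _)
        (hπ.definable_eq (m := fun _ : Fin 2 × Fin 4 → A => 1)
          (n := fun z => ofEntries (fun j => z (0, j)) * ofEntries (fun j => z (1, j)))
          (.const 1) (.mul (.ofEntries fun _ => .proj _) (.ofEntries fun _ => .proj _))) using 1
      ext z
      simp only [pullback, Set.mem_ofPred_eq]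
      rw [← exists_prop]
      exact exists_congr fun h => inv_map_mk_eq_iff (h 0) (h 1)
    | one =>
      convert definable_and (definable_forall_finite fun i : Fin 1 => definable_det
        (t := fun j z => z (i, j)) fun _ => .proj _)
        (hπ.definable_eq (m := fun _ : Fin 1 × Fin 4 → A => 1)
          (n := fun z => ofEntries (fun j => z (0, j)))
          (.const 1) (.ofEntries fun _ => .proj _)) using 1
      ext z
      simp only [pullback, Set.mem_ofPred_eq]
      rw [← exists_prop]
      exact exists_congr fun h => one_eq_map_mk_iff (h 0)
  definable_rel _ R := nomatch R

theorem root_injective (hπ : DefinableCentralQuotient π) : Function.Injective (root π) :=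
  fun _ _ h => eq_of_map_upper_eq hπ.ker_le h

/-- The element of `A` that an element of the root group represents. -/
noncomputable def rootValue (π : SL₂ A →* G)
    (z : {z : Fin 1 → G | ∃ x, z 0 = root π x}) : A := z.2.choose

theorem rootValue_eq_iff (hπ : DefinableCentralQuotient π)
    (z : {z : Fin 1 → G | ∃ x, z 0 = root π x}) (x : A) :
    rootValue π z = x ↔ z.1 0 = root π x := by
  have h : z.1 0 = root π (rootValue π z) := z.2.choose_spec
  rw [h, (root_injective hπ).eq_iff]

/-- By injectivity of `root π` the chosen value is the only one, so choice disappears from the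
definability goals. -/
theorem pullback_rootValue (hπ : DefinableCentralQuotient π) {k : ℕ} (S : Set (Fin k → A)) :
    pullback (rootValue π) S = {z | ∃ x ∈ S, ∀ i, z (i, 0) = root π (x i)} := by
  ext z
  constructor
  · rintro ⟨h, hS⟩
    exact ⟨_, hS, fun i => (rootValue_eq_iff hπ ⟨_, h i⟩ _).1 rfl⟩
  · rintro ⟨x, hS, hx⟩
    refine ⟨fun i => ⟨x i, hx i⟩, ?_⟩
    convert hS with i
    exact (rootValue_eq_iff hπ _ _).2 (hx i)

/-- The interpretation of `A` in a quotient of `SL₂(A)` by the root group. -/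
noncomputable def ringInterpretation (hA : UnitRich A) (hπ : DefinableCentralQuotient π) :
    Interpretation gp G Language.ring A where
  dim := 1
  dom := {z | ∃ x, z 0 = root π x}
  map := rootValue π
  surjective x := ⟨⟨fun _ => root π x, x, rfl⟩, (rootValue_eq_iff hπ _ _).2 rfl⟩
  definable_dom := definable_root_group hA hπ
  definable_eq := by
    have h : pullback (rootValue π) {y : Fin 2 → A | y 0 = y 1} =
        {z | (∃ x, z (0, 0) = root π x) ∧ z (1, 0) = z (0, 0)} := by
      rw [pullback_rootValue hπ]
      ext z
      constructor
      · rintro ⟨x, hx, hz⟩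
        exact ⟨⟨_, hz 0⟩, by rw [hz 0, hz 1, hx]⟩
      · rintro ⟨⟨x, hx⟩, h⟩
        exact ⟨fun _ => x, rfl, Fin.forall_fin_two.2 ⟨hx, h.trans hx⟩⟩
    rw [h]
    exact definable_and (definable_mem (definable_root_group hA hπ) (.proj _))
      (Set.DefinableFun.ofPred_eq (.proj _) (.proj _))
  definable_fun k F := by
    have hU := definable_root_group hA hπ
    rw [pullback_rootValue hπ]
    cases F with
    | add =>
      convert definable_and (definable_mem hU (t := fun z : Fin 3 × Fin 1 → G => z (0, 0))
        (.proj _)) (definable_and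
        (definable_mem hU (t := fun z : Fin 3 × Fin 1 → G => z (1, 0)) (.proj _))
        (Set.DefinableFun.ofPred_eq (f := fun z : Fin 3 × Fin 1 → G => z (2, 0)) (.proj _)
          (definableFun_group_mul (s := fun z => z (0, 0)) (t := fun z => z (1, 0))
            (.proj _) (.proj _)))) using 1
      ext z
      constructor
      · rintro ⟨x, hx, hz⟩
        refine ⟨⟨_, hz 0⟩, ⟨_, hz 1⟩, ?_⟩
        rw [hz 0, hz 1, hz 2, ← root_add]
        exact congrArg _ hx.symm
      · rintro ⟨⟨x, hx⟩, ⟨y, hy⟩, h⟩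
        refine ⟨![x, y, x + y], rfl, ?_⟩
        rw [hx, hy, ← root_add] at h
        intro i
        fin_cases i
        exacts [hx, hy, h]
    | mul =>
      convert definable_preimage (definable_mulGraph hA hπ)
        (t := fun i (z : Fin 3 × Fin 1 → G) => z (i, 0)) (fun _ => .proj _) using 1
      ext z
      constructor
      · rintro ⟨x, hx, hz⟩
        exact ⟨x 0, x 1, hz 0, hz 1, (hz 2).trans (congrArg _ hx.symm)⟩
      · rintro ⟨x, y, hx, hy, h⟩
        refine ⟨![x, y, x * y], rfl, ?_⟩
        intro i
        fin_cases i
        exacts [hx, hy, h]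
    | neg =>
      convert definable_and (definable_mem hU (t := fun z : Fin 2 × Fin 1 → G => z (0, 0))
        (.proj _)) (Set.DefinableFun.ofPred_eq (f := fun z : Fin 2 × Fin 1 → G => z (1, 0))
          (.proj _) (definableFun_group_inv (s := fun z => z (0, 0)) (.proj _))) using 1
      ext z
      constructor
      · rintro ⟨x, hx, hz⟩
        refine ⟨⟨_, hz 0⟩, ?_⟩
        rw [hz 0, hz 1, ← root_neg]
        exact congrArg _ hx.symm
      · rintro ⟨⟨x, hx⟩, h⟩
        refine ⟨![x, -x], rfl, ?_⟩
        rw [hx, ← root_neg] at h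
        intro i
        fin_cases i
        exacts [hx, h]
    | zero =>
      convert Set.DefinableFun.ofPred_eq (f := fun z : Fin 1 × Fin 1 → G => z (0, 0))
        (.proj _) (definableFun_const_univ (root π 0)) using 1
      ext z
      constructor
      · rintro ⟨x, hx, hz⟩
        exact (hz 0).trans (congrArg _ hx.symm)
      · intro h
        exact ⟨fun _ => 0, rfl, fun i => by fin_cases i; exact h⟩
    | one =>
      convert Set.DefinableFun.ofPred_eq (f := fun z : Fin 1 × Fin 1 → G => z (0, 0))
        (.proj _) (definableFun_const_univ (root π 1)) using 1
      ext z
      constructor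
      · rintro ⟨x, hx, hz⟩
        exact (hz 0).trans (congrArg _ hx.symm)
      · intro h
        exact ⟨fun _ => 1, rfl, fun i => by fin_cases i; exact h⟩
  definable_rel _ R := nomatch R

/-! ### The composite interpretations -/

theorem mem_compGraph_ring (hA : UnitRich A) (hπ : DefinableCentralQuotient π)
    (z : Option (Fin 1 × Fin 4) → A) :
    z ∈ (groupInterpretation hπ).compGraph (ringInterpretation hA hπ) ↔
      ∃ h : z (some (0, 0)) * z (some (0, 3)) - z (some (0, 1)) * z (some (0, 2)) = 1,
        π (mk (fun i => z (some (0, i))) h) = π (upper (z none)) := by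
  constructor
  · rintro ⟨hI, hJ, h⟩
    exact ⟨hI (0 : Fin 1), (rootValue_eq_iff hπ _ _).1 h⟩
  · rintro ⟨hI, h⟩
    have hI' : ∀ j : Fin 1, z (some (j, 0)) * z (some (j, 3)) -
        z (some (j, 1)) * z (some (j, 2)) = 1 := fun j => by
      rw [Subsingleton.elim j 0]; exact hI
    exact ⟨hI', ⟨_, h⟩, (rootValue_eq_iff hπ ⟨_, ⟨_, h⟩⟩ _).2 h⟩

theorem mem_compGraph_group (hA : UnitRich A) (hπ : DefinableCentralQuotient π)
    (z : Option (Fin 4 × Fin 1) → G) :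
    z ∈ (ringInterpretation hA hπ).compGraph (groupInterpretation hπ) ↔
      ∃ (x : Fin 4 → A) (h : x 0 * x 3 - x 1 * x 2 = 1),
        (∀ j, z (some (j, 0)) = root π (x j)) ∧ π (mk x h) = z none := by
  constructor
  · rintro ⟨hI, hJ, h⟩
    exact ⟨fun j => rootValue π ⟨_, hI j⟩, hJ, fun j => (rootValue_eq_iff hπ ⟨_, hI j⟩ _).1 rfl, h⟩
  · rintro ⟨x, hv, hx, h⟩
    have hI : ∀ j : Fin 4, (fun i => z (some (j, i))) ∈ {z : Fin 1 → G | ∃ x, z 0 = root π x} :=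
      fun j => ⟨x j, hx j⟩
    have hxe : (fun j => rootValue π ⟨_, hI j⟩) = x :=
      funext fun j => (rootValue_eq_iff hπ ⟨_, hI j⟩ _).2 (hx j)
    subst hxe
    exact ⟨hI, hv, h⟩

theorem definable_compGraph_ring (hA : UnitRich A) (hπ : DefinableCentralQuotient π) :
    (Set.univ : Set A).Definable Language.ring
      ((groupInterpretation hπ).compGraph (ringInterpretation hA hπ)) := by
  refine definable_congr (α := Option (Fin 1 × Fin 4)) (definable_and (definable_det
    (t := fun i (z : Option (Fin 1 × Fin 4) → A) => z (some (0, i))) fun _ => .proj _)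
    (hπ.definable_eq (m := fun z : Option (Fin 1 × Fin 4) → A =>
        ofEntries fun i => z (some (0, i)))
      (n := fun z => (upper (z none) : M₂ A))
      (.ofEntries fun _ => .proj _) (.upper (.proj _)))) fun z => ?_
  refine (mem_compGraph_ring hA hπ z).trans ?_
  rw [Set.mem_ofPred_eq, ← exists_prop]
  exact exists_congr fun h => map_eq_map_iff _ _

theorem map_mk_elementary (π : SL₂ A →* G) {p q r s : A} {x : Fin 4 → A}
    (hv : x 0 * x 3 - x 1 * x 2 = 1) (h0 : x 0 = 1 + q * r) (h1 : x 1 = q + s * x 0)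
    (h2 : x 2 = r + p * x 0) (h3 : x 3 = 1 + r * s + p * x 1) :
    π (mk x hv) = (π weyl * (root π p)⁻¹ * π weyl⁻¹) * root π q *
      (π weyl * (root π r)⁻¹ * π weyl⁻¹) * root π s := by
  simp only [root, ← map_inv, ← map_mul]
  refine congrArg π (Subtype.ext (Eq.trans ?_ (coe_elementary_mul p q r s).symm))
  rw [h1, h0] at h3
  rw [h0] at h1 h2
  simp only [mk, ofEntries, h0, h1, h2, h3]

/-- Here `u` holds the roots of the four parameters p, q, r, s of the elementary factorization, and
`m` the roots of the products qr, s x₀, p x₀, rs, p x₁ occurring in the entries. What remains are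
group equations and instances of `mulGraph`. -/
theorem mem_compGraph_group_iff_elementary (hA : UnitRich A) (hπ : DefinableCentralQuotient π)
    (z : Option (Fin 4 × Fin 1) → G) :
    z ∈ (ringInterpretation hA hπ).compGraph (groupInterpretation hπ) ↔
      ∃ u : Fin 4 → G, ∃ m : Fin 5 → G,
        (![u 1, u 2, m 0] ∈ mulGraph π ∧ ![u 3, z (some (0, 0)), m 1] ∈ mulGraph π ∧
          ![u 0, z (some (0, 0)), m 2] ∈ mulGraph π ∧ ![u 2, u 3, m 3] ∈ mulGraph π ∧
          ![u 0, z (some (1, 0)), m 4] ∈ mulGraph π) ∧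
        (z (some (0, 0)) = root π 1 * m 0 ∧ z (some (1, 0)) = u 1 * m 1 ∧
          z (some (2, 0)) = u 2 * m 2 ∧ z (some (3, 0)) = root π 1 * m 3 * m 4) ∧
        z none = (π weyl * (u 0)⁻¹ * π weyl⁻¹) * u 1 *
          (π weyl * (u 2)⁻¹ * π weyl⁻¹) * u 3 := by
  rw [mem_compGraph_group]
  constructor
  · rintro ⟨x, hv, hx, h⟩
    obtain ⟨p, q, r, s, h0, h1, h2, h3⟩ := exists_entries_eq hA.stable_rank hv
    refine ⟨fun i => root π (![p, q, r, s] i),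
      fun i => root π (![q * r, s * x 0, p * x 0, r * s, p * x 1] i),
      ⟨⟨q, r, rfl, rfl, rfl⟩, ⟨s, x 0, rfl, hx 0, rfl⟩, ⟨p, x 0, rfl, hx 0, rfl⟩,
        ⟨r, s, rfl, rfl, rfl⟩, ⟨p, x 1, rfl, hx 1, rfl⟩⟩, ⟨?_, ?_, ?_, ?_⟩,
      h.symm.trans (map_mk_elementary π hv h0 h1 h2 h3)⟩
    · rw [hx, h0, root_add]; rfl
    · rw [hx, h1, root_add]; rfl
    · rw [hx, h2, root_add]; rfl
    · rw [hx, h3, root_add, root_add]; rfl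
  · rintro ⟨u, m, ⟨⟨q, r, hq, hr, hm0⟩, ⟨s, x0, hs, hx0, hm1⟩, ⟨p, x0', hp, hx0', hm2⟩,
      ⟨r', s', hr', hs', hm3⟩, ⟨p', x1, hp', hx1, hm4⟩⟩, ⟨h0, h1, h2, h3⟩, h⟩
    -- Each `mulGraph` condition supplies its own ring elements; injectivity identifies those with
    -- the same root.
    have inj := root_injective hπ
    simp only [cons_val] at hq hr hm0 hs hx0 hm1 hp hx0' hm2 hr' hs' hm3 hp' hx1 hm4
    obtain rfl := inj (hr.symm.trans hr')
    obtain rfl := inj (hs.symm.trans hs')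
    obtain rfl := inj (hp.symm.trans hp')
    obtain rfl := inj (hx0.symm.trans hx0')
    rw [hm0, ← root_add] at h0
    obtain rfl := inj (hx0.symm.trans h0)
    rw [hq, hm1, ← root_add] at h1
    obtain rfl := inj (hx1.symm.trans h1)
    rw [hr, hm2, ← root_add] at h2
    rw [hm3, hm4, ← root_add, ← root_add] at h3
    refine ⟨![1 + q * r, q + s * (1 + q * r), r + p * (1 + q * r),
      1 + r * s + p * (q + s * (1 + q * r))], ?_, ?_, ?_⟩
    · simp only [cons_val]
      ring
    · intro j
      fin_cases j
      exacts [h0, h1, h2, h3]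
    · rw [h, hp, hq, hr, hs]
      exact map_mk_elementary π _ rfl rfl rfl rfl

theorem definable_compGraph_group (hA : UnitRich A) (hπ : DefinableCentralQuotient π) :
    (Set.univ : Set G).Definable gp
      ((ringInterpretation hA hπ).compGraph (groupInterpretation hπ)) := by
  have hM : ∀ {t : Fin 3 → (((Option (Fin 4 × Fin 1)) ⊕ Fin 4) ⊕ Fin 5 → G) → G},
      (∀ i, (Set.univ : Set G).DefinableFun gp (t i)) →
      (Set.univ : Set G).Definable gp {w | ![t 0 w, t 1 w, t 2 w] ∈ mulGraph π} := by
    intro t ht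
    refine definable_congr (definable_preimage (definable_mulGraph hA hπ) ht) fun w => ?_
    have e : ![t 0 w, t 1 w, t 2 w] = fun i => t i w := by
      ext i
      fin_cases i <;> rfl
    rw [Set.mem_ofPred_eq, e]
    rfl
  have hW : ∀ {t : (((Option (Fin 4 × Fin 1)) ⊕ Fin 4) ⊕ Fin 5 → G) → G},
      (Set.univ : Set G).DefinableFun gp t →
      (Set.univ : Set G).DefinableFun gp (fun w => π weyl * (t w)⁻¹ * π weyl⁻¹) :=
    fun ht => definableFun_group_mul (definableFun_group_mul (definableFun_const_univ _)
      (definableFun_group_inv ht)) (definableFun_const_univ _)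
  refine definable_congr (α := Option (Fin 4 × Fin 1)) ?_
    (mem_compGraph_group_iff_elementary hA hπ)
  refine definable_exists_tuple (definable_exists_tuple (definable_and
    (definable_and (hM (t := ![_, _, _]) ?_) (definable_and (hM (t := ![_, _, _]) ?_)
      (definable_and (hM (t := ![_, _, _]) ?_) (definable_and (hM (t := ![_, _, _]) ?_)
        (hM (t := ![_, _, _]) ?_))))) (definable_and
    (definable_and (Set.DefinableFun.ofPred_eq ?_ ?_) (definable_and
      (Set.DefinableFun.ofPred_eq ?_ ?_) (definable_and (Set.DefinableFun.ofPred_eq ?_ ?_)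
        (Set.DefinableFun.ofPred_eq ?_ ?_)))) (Set.DefinableFun.ofPred_eq ?_ ?_))))
  iterate 5
    · intro i
      fin_cases i
      exacts [.proj _, .proj _, .proj _]
  · exact .proj _
  · exact definableFun_group_mul (definableFun_const_univ _) (.proj _)
  · exact .proj _
  · exact definableFun_group_mul (.proj _) (.proj _)
  · exact .proj _
  · exact definableFun_group_mul (.proj _) (.proj _)
  · exact .proj _
  · exact definableFun_group_mul (definableFun_group_mul (definableFun_const_univ _) (.proj _))
      (.proj _)
  · exact .proj _
  · exact definableFun_group_mul (definableFun_group_mul (definableFun_group_mul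
      (hW (.proj _)) (.proj _)) (hW (.proj _))) (.proj _)

theorem ringGroupBiInterpretable (hA : UnitRich A) (hπ : DefinableCentralQuotient π) :
    RingGroupBiInterpretable A G :=
  ⟨groupInterpretation hπ, ringInterpretation hA hπ, definable_compGraph_ring hA hπ,
    definable_compGraph_group hA hπ⟩

/-! ### The three quotients -/

theorem definable_entries_eq (w : Fin 4 → A) :
    (Set.univ : Set A).Definable Language.ring {v : Fin 4 → A | ofEntries v = ofEntries w} :=
  DefinableMatrix.definable_eq (.ofEntries fun _ => .proj _) (.const _)

theorem ofEntries_one : (ofEntries ![1, 0, 0, 1] : M₂ A) = 1 := by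
  simp [ofEntries, one_fin_two]

theorem definableCentralQuotient_id : DefinableCentralQuotient (MonoidHom.id (SL₂ A)) where
  surjective := Function.surjective_id
  ker_le := by simp
  definable_ker := by
    convert definable_entries_eq (A := A) ![1, 0, 0, 1] using 1
    ext v
    simp [ofEntries_one, eq_comm]

theorem definableCentralQuotient_zpowers_neg_one :
    DefinableCentralQuotient (QuotientGroup.mk' (Subgroup.zpowers (-1 : SL₂ A))) where
  surjective := QuotientGroup.mk'_surjective _
  ker_le := by
    rw [QuotientGroup.ker_mk', Subgroup.zpowers_le, Subgroup.mem_center_iff]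
    simp
  definable_ker := by
    convert definable_or (definable_entries_eq (A := A) ![1, 0, 0, 1])
      (definable_entries_eq (A := A) ![-1, 0, 0, -1]) using 1
    have hneg : (ofEntries ![-1, 0, 0, -1] : M₂ A) = -1 := by
      simp [ofEntries, one_fin_two]
    have hsq : (-1 : SL₂ A) ^ (2 : ℤ) = 1 := by simp
    ext v
    rw [QuotientGroup.ker_mk']
    simp only [Set.mem_ofPred_eq, ofEntries_one, hneg]
    constructor
    · rintro ⟨g, ⟨n, rfl⟩, hg⟩
      rcases Int.even_or_odd n with hn | hn
      · left; rw [← hg]; simp [hn.neg_one_zpow]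
      · right; rw [← hg]; simp [hn.neg_one_zpow]
    · rintro (h | h)
      · exact ⟨1, one_mem _, by simp [h]⟩
      · exact ⟨-1, Subgroup.mem_zpowers _, by simp [h]⟩

theorem definableCentralQuotient_center :
    DefinableCentralQuotient (QuotientGroup.mk' (Subgroup.center (SL₂ A))) where
  surjective := QuotientGroup.mk'_surjective _
  ker_le := by rw [QuotientGroup.ker_mk']
  definable_ker := by
    -- The centre consists of the scalars with r² = 1, a condition on one ring variable.
    convert definable_exists (L := Language.ring) (M := A)
      (P := fun (v : Fin 4 → A) r => r * r = 1 ∧ ofEntries v = ofEntries fun i => ![r, 0, 0, r] i)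
      (definable_and (Set.DefinableFun.ofPred_eq
        (definableFun_ring_mul (.proj _) (.proj _)) (definableFun_const_univ _))
        (DefinableMatrix.definable_eq (.ofEntries fun _ => .proj _)
          (.ofEntries (t := fun i w => ![w (.inr 0), 0, 0, w (.inr 0)] i) ?_))) using 1
    · ext v
      rw [QuotientGroup.ker_mk']
      have hs : ∀ r : A, ofEntries ![r, 0, 0, r] = scalar (Fin 2) r := fun r => by
        ext i j
        fin_cases i <;> fin_cases j <;> simp [ofEntries]
      simp only [Set.mem_ofPred_eq, Matrix.SpecialLinearGroup.mem_center_iff, hs, Fintype.card_fin]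
      constructor
      · rintro ⟨g, ⟨r, hr, hg⟩, h⟩
        exact ⟨r, by rw [← pow_two, hr], by rw [← h, hg]⟩
      · rintro ⟨r, hr, h⟩
        exact ⟨mk ![r, 0, 0, r] (by simpa using hr), ⟨r, by rw [pow_two, hr], (hs r).symm⟩,
          by rw [h]; exact hs r⟩
    · intro i
      fin_cases i
      exacts [.proj _, definableFun_const_univ _, definableFun_const_univ _, .proj _]

theorem UnitRich.biInterpretable (hA : UnitRich A) : BiInterpretableWithSL2s A :=
  ⟨ringGroupBiInterpretable hA definableCentralQuotient_id,
    ringGroupBiInterpretable hA definableCentralQuotient_zpowers_neg_one,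
    ringGroupBiInterpretable hA definableCentralQuotient_center⟩

end SpecialLinearTwo

/-! ### Products and restricted products of local rings -/

namespace SpecialLinearTwo

/-! ### Unit conditions in local rings -/

section Local

variable {R : Type*} [CommRing R] [IsLocalRing R]

/-- If c lies in the maximal ideal, coprimality forces a to be a unit, and then c + a is one. -/
theorem exists_isUnit_add_mul_of_isCoprime {a c : R} (h : IsCoprime a c) :
    ∃ s, IsUnit (c + s * a) := by
  by_cases hc : IsUnit c
  · exact ⟨0, by simpa using hc⟩
  · obtain ⟨p, q, hpq⟩ := h
    have ha : IsUnit a := by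
      rcases IsLocalRing.isUnit_or_isUnit_of_add_one hpq with h | h
      · exact isUnit_of_mul_isUnit_right h
      · exact absurd (isUnit_of_mul_isUnit_right h) hc
    refine ⟨1, ?_⟩
    by_contra hn
    have := IsLocalRing.nonunits_add hn (b := -c) (by simpa using hc)
    exact this (by simpa using ha)

theorem isUnit_two_or_isUnit_three : IsUnit (2 : R) ∨ IsUnit (3 : R) := by
  rcases IsLocalRing.isUnit_or_isUnit_of_add_one (a := (3 : R)) (b := -2) (by norm_num) with h | h
  · exact .inr h
  · exact .inl (by simpa using h)

theorem isUnit_add_one_and_isUnit_sub_one {x : R} (hx : ¬ IsUnit x) :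
    IsUnit (x + 1) ∧ IsUnit (x - 1) := by
  constructor
  · by_contra h
    have := IsLocalRing.nonunits_add h (b := -x) (by simpa using hx)
    exact this (by simp)
  · by_contra h
    have := IsLocalRing.nonunits_add h (b := -x) (by simpa using hx)
    exact this (by rw [show x - 1 + -x = -1 by ring]; exact isUnit_one.neg)

/-- Neither y nor z may be ±1 in the residue field. If 6 is not a unit, 6x + 0 works. Otherwise 0, 2
and -2 are all allowed for y, and one of them moves 6x - y away from ±1. -/
theorem exists_add_eq_six_mul (x : R) : ∃ y z : R, y + z = 6 * x ∧
    (IsUnit (y + 1) ∧ IsUnit (y - 1)) ∧ IsUnit (z + 1) ∧ IsUnit (z - 1) := by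
  by_cases h6 : IsUnit (6 : R)
  · have h2 : IsUnit (2 : R) := isUnit_of_mul_isUnit_left (y := 3) (by norm_num [h6])
    have h3 : IsUnit (3 : R) := isUnit_of_mul_isUnit_left (y := 2) (by norm_num [h6])
    have key : ∀ u v : R, IsUnit (u - v) → ¬ IsUnit u → IsUnit v := by
      intro u v huv hu
      by_contra hv
      have := IsLocalRing.nonunits_add hu (b := -v) (by simpa using hv)
      exact this (by simpa [sub_eq_add_neg] using huv)
    have h4 : IsUnit (4 : R) := by convert h2.mul h2 using 1; norm_num
    have hgood : ∀ y : R, y = 0 ∨ y = 2 ∨ y = -2 → IsUnit (y + 1) ∧ IsUnit (y - 1) := by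
      rintro y (rfl | rfl | rfl)
      · simp
      · norm_num [h3]
      · norm_num [h3]
    suffices h : ∃ y : R, (y = 0 ∨ y = 2 ∨ y = -2) ∧
        IsUnit (6 * x - y + 1) ∧ IsUnit (6 * x - y - 1) by
      obtain ⟨y, hy, h1, h1'⟩ := h
      exact ⟨y, 6 * x - y, by ring, hgood y hy, h1, h1'⟩
    by_cases h0 : IsUnit (6 * x + 1)
    · by_cases h0' : IsUnit (6 * x - 1)
      · exact ⟨0, by simp, by simpa using h0, by simpa using h0'⟩
      -- Here 6x is 1 in the residue field, so z = 6x + 2 is 3, and z ± 1 reduce to the units 4 and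
      -- 2. The next case is its mirror image.
      · refine ⟨-2, by simp, key _ _ ?_ h0', key _ _ ?_ h0'⟩
        · convert h4.neg using 1; ring
        · convert h2.neg using 1; ring
    · refine ⟨2, by simp, key _ _ ?_ h0, key _ _ ?_ h0⟩
      · convert h2 using 1; ring
      · convert h4 using 1; ring
  · have h : ¬ IsUnit (6 * x) := fun h => h6 (isUnit_of_mul_isUnit_left h)
    refine ⟨6 * x, 0, by simp, isUnit_add_one_and_isUnit_sub_one h, by simp, by simp⟩

/-- In a local domain in which `2`, `3` and `5` do not vanish, one of the units `2` and `3` has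
a fourth power different from `1`. -/
theorem exists_unit_sq_ne [IsDomain R] (h2 : (2 : R) ≠ 0) (h3 : (3 : R) ≠ 0)
    (h5 : (5 : R) ≠ 0) : ∃ a : R, IsUnit a ∧ a ^ 2 - 1 ≠ 0 ∧ a ^ 2 + 1 ≠ 0 := by
  rcases isUnit_two_or_isUnit_three (R := R) with h | h
  · exact ⟨2, h, by norm_num [h3], by norm_num [h5]⟩
  · refine ⟨3, h, ?_, ?_⟩
    · convert pow_ne_zero 3 h2 using 1; norm_num
    · convert mul_ne_zero h2 h5 using 1; norm_num

end Local

/-- Representatives are chosen freely at the finitely many indices where m is not invertible, and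
are 0 elsewhere. -/
theorem exists_finset_residues_pi {ι : Type*} {R : ι → Type*} [∀ i, CommRing (R i)] {m : ℕ}
    (hfin : {i | ¬ IsUnit (m : R i)}.Finite)
    (hres : ∀ i, ¬ IsUnit (m : R i) →
      ∃ F : Finset (R i), ∀ x, ∃ c ∈ F, ∃ y, x = c + m * y) :
    ∃ F : Finset (∀ i, R i), ∀ x, ∃ c ∈ F, ∃ y, x = c + m * y := by
  classical
  have := hfin.to_subtype
  choose F hF using hres
  let e : (∀ i : {i | ¬ IsUnit (m : R i)}, F i.1 i.2) → ∀ i, R i :=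
    fun f i => if h : ¬ IsUnit (m : R i) then (f ⟨i, h⟩ : R i) else 0
  refine ⟨(Set.finite_range e).toFinset, fun x => ?_⟩
  have hx : ∀ i (h : ¬ IsUnit (m : R i)), ∃ c : F i h, ∃ y, x i = c + m * y := fun i h => by
    obtain ⟨c, hc, y, hy⟩ := hF i h (x i)
    exact ⟨⟨c, hc⟩, y, hy⟩
  choose c hc using hx
  refine ⟨e fun i => c i.1 i.2, by simp, ?_⟩
  have hy : ∀ i, ∃ y, x i = e (fun i => c i.1 i.2) i + m * y := by
    intro i
    by_cases h : IsUnit (m : R i)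
    · obtain ⟨u, hu⟩ := h
      refine ⟨((u⁻¹ : (R i)ˣ) : R i) * x i, ?_⟩
      simp [e, ← hu]
    · obtain ⟨y, hy⟩ := hc i h
      exact ⟨y, by simpa [e, h] using hy⟩
  choose y hy using hy
  exact ⟨y, funext fun i => by simpa using hy i⟩

theorem UnitRich.pi {ι : Type*} {R : ι → Type*} [∀ i, CommRing (R i)] [∀ i, IsDomain (R i)]
    [∀ i, IsLocalRing (R i)] (h2 : ∀ i, (2 : R i) ≠ 0) (h3 : ∀ i, (3 : R i) ≠ 0)
    (h5 : ∀ i, (5 : R i) ≠ 0)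
    (hres : ∃ F : Finset (∀ i, R i), ∀ x, ∃ c ∈ F, ∃ y, x = c + 24 * y) :
    UnitRich (∀ i, R i) where
  two_mul_eq_zero x hx := funext fun i => by
    have := congrFun hx i
    simpa [h2] using this
  exists_unit := by
    choose a ha h h' using fun i => exists_unit_sq_ne (h2 i) (h3 i) (h5 i)
    obtain ⟨u, rfl⟩ := Pi.isUnit_iff.2 ha
    refine ⟨u, fun x hx => funext fun i => ?_, fun x hx => funext fun i => ?_⟩
    · exact (mul_eq_zero.1 (congrFun hx i)).resolve_left (h i)
    · exact (mul_eq_zero.1 (congrFun hx i)).resolve_left (h' i)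
  finite_residues := hres
  exists_add_eq x := by
    choose y z h hy hz using fun i => exists_add_eq_six_mul (x i)
    exact ⟨y, z, funext h, ⟨Pi.isUnit_iff.2 fun i => (hy i).1, Pi.isUnit_iff.2 fun i => (hy i).2⟩,
      Pi.isUnit_iff.2 fun i => (hz i).1, Pi.isUnit_iff.2 fun i => (hz i).2⟩
  stable_rank a c h := by
    have hi : ∀ i, IsCoprime (a i) (c i) := fun i => by
      obtain ⟨p, q, hpq⟩ := h
      exact ⟨p i, q i, congrFun hpq i⟩
    choose s hs using fun i => exists_isUnit_add_mul_of_isCoprime (hi i)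
    exact ⟨s, Pi.isUnit_iff.2 hs⟩

/-! ### Restricted products -/

section Restricted

theorem isLocalRing_of_mem_or_inv_mem {F : Type*} [Field F] {O : Subring F}
    (h : ∀ x, x ∈ O ∨ x⁻¹ ∈ O) : IsLocalRing O :=
  inferInstanceAs (IsLocalRing (⟨O, h⟩ : ValuationSubring F))

theorem ne_zero_and_inv_mem_of_isUnit {F : Type*} [Field F] {O : Subring F} {x : O}
    (hx : IsUnit x) : (x : F) ≠ 0 ∧ (x : F)⁻¹ ∈ O := by
  obtain ⟨u, rfl⟩ := hx
  have h : (u : O).1 * (u⁻¹ : Oˣ).1.1 = 1 := by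
    rw [← Subring.coe_mul, Units.mul_inv, Subring.coe_one]
  refine ⟨left_ne_zero_of_mul_eq_one h, ?_⟩
  rw [inv_eq_of_mul_eq_one_right h]
  exact (u⁻¹ : Oˣ).1.2

open Filter

variable {ι : Type*} {F : ι → Type*} [∀ i, Field (F i)] {O : ∀ i, Subring (F i)}

theorem isUnit_restrictedProduct
    {x : RestrictedProduct F (fun i => (O i : Set (F i))) cofinite} (hx : ∀ i, x i ≠ 0)
    (hx' : ∀ᶠ i in cofinite, (x i)⁻¹ ∈ O i) : IsUnit x :=
  IsUnit.of_mul_eq_one ⟨fun i => (x i)⁻¹, hx'⟩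
    (RestrictedProduct.ext _ _ fun i => mul_inv_cancel₀ (hx i))

theorem UnitRich.restrictedProduct (hO : ∀ i x, x ∈ O i ∨ x⁻¹ ∈ O i)
    (h2 : ∀ i, (2 : F i) ≠ 0) (h3 : ∀ i, (3 : F i) ≠ 0) (h5 : ∀ i, (5 : F i) ≠ 0)
    (h24 : ∀ᶠ i in cofinite, (24 : F i)⁻¹ ∈ O i) :
    UnitRich (RestrictedProduct F (fun i => (O i : Set (F i))) cofinite) := by
  have : ∀ i, IsLocalRing (O i) := fun i => isLocalRing_of_mem_or_inv_mem (hO i)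
  -- In the restricted product 24 is a unit, so 0 represents the only residue.
  refine ⟨fun x hx => ?_, ?_, ⟨{0}, fun x => ⟨0, by simp, ?_⟩⟩, fun x => ?_, fun a c h => ?_⟩
  · refine RestrictedProduct.ext _ _ fun i => ?_
    exact (mul_eq_zero.1 (congrArg (fun x => x i) hx)).resolve_left (h2 i)
  · have hne : ∀ i, (2 : O i) ≠ 0 ∧ (3 : O i) ≠ 0 ∧ (5 : O i) ≠ 0 := fun i =>
      ⟨fun h => h2 i (congrArg Subtype.val h), fun h => h3 i (congrArg Subtype.val h),
        fun h => h5 i (congrArg Subtype.val h)⟩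
    choose a ha h h' using fun i => exists_unit_sq_ne (hne i).1 (hne i).2.1 (hne i).2.2
    let a' : RestrictedProduct F (fun i => (O i : Set (F i))) cofinite :=
      ⟨fun i => a i, .of_forall fun i => (a i).2⟩
    obtain ⟨u, hu⟩ := isUnit_restrictedProduct (x := a')
      (fun i => (ne_zero_and_inv_mem_of_isUnit (ha i)).1)
      (.of_forall fun i => (ne_zero_and_inv_mem_of_isUnit (ha i)).2)
    refine ⟨u, fun x hx => ?_, fun x hx => ?_⟩ <;> rw [hu] at hx <;>
      refine RestrictedProduct.ext _ _ fun i => ?_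
    · exact (mul_eq_zero.1 (congrArg (fun x => x i) hx)).resolve_left
        fun e => h i (Subtype.ext e)
    · exact (mul_eq_zero.1 (congrArg (fun x => x i) hx)).resolve_left
        fun e => h' i (Subtype.ext e)
  · have hne : ∀ i, (24 : F i) ≠ 0 := fun i => by
      convert mul_ne_zero (pow_ne_zero 3 (h2 i)) (h3 i) using 1; norm_num
    obtain ⟨u, hu⟩ := isUnit_restrictedProduct
      (x := (24 : RestrictedProduct F (fun i => (O i : Set (F i))) cofinite)) hne h24
    exact ⟨((u⁻¹ : Units _) : RestrictedProduct F (fun i => (O i : Set (F i))) cofinite) * x,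
      by rw [← hu, Units.mul_inv_cancel_left, zero_add]⟩
  -- Where x is integral the equation is solved in the local ring `O i`; at the remaining finitely
  -- many indices it is solved in the field `F i`, with no integrality required.
  · have hloc : ∀ i, ∃ y z : F i, y + z = 6 * x i ∧
        (y + 1 ≠ 0 ∧ y - 1 ≠ 0 ∧ z + 1 ≠ 0 ∧ z - 1 ≠ 0) ∧
        (x i ∈ O i → y ∈ O i ∧ z ∈ O i ∧ (y + 1)⁻¹ ∈ O i ∧ (y - 1)⁻¹ ∈ O i ∧
          (z + 1)⁻¹ ∈ O i ∧ (z - 1)⁻¹ ∈ O i) := by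
      intro i
      by_cases hi : x i ∈ O i
      · obtain ⟨y, z, h, ⟨hy, hy'⟩, hz, hz'⟩ := exists_add_eq_six_mul (⟨x i, hi⟩ : O i)
        have hy := ne_zero_and_inv_mem_of_isUnit hy
        have hy' := ne_zero_and_inv_mem_of_isUnit hy'
        have hz := ne_zero_and_inv_mem_of_isUnit hz
        have hz' := ne_zero_and_inv_mem_of_isUnit hz'
        exact ⟨y, z, congrArg Subtype.val h, ⟨hy.1, hy'.1, hz.1, hz'.1⟩,
          fun _ => ⟨y.2, z.2, hy.2, hy'.2, hz.2, hz'.2⟩⟩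
      · obtain ⟨y, z, h, ⟨hy, hy'⟩, hz, hz'⟩ := exists_add_eq_six_mul (x i)
        exact ⟨y, z, h, ⟨hy.ne_zero, hy'.ne_zero, hz.ne_zero, hz'.ne_zero⟩, fun h => absurd h hi⟩
    choose y z h hne hmem using hloc
    have hx := x.eventually
    refine ⟨⟨y, hx.mono fun i hi => (hmem i hi).1⟩, ⟨z, hx.mono fun i hi => (hmem i hi).2.1⟩,
      RestrictedProduct.ext _ _ h, ⟨?_, ?_⟩, ?_, ?_⟩
    · exact isUnit_restrictedProduct (fun i => (hne i).1)
        (hx.mono fun i hi => (hmem i hi).2.2.1)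
    · exact isUnit_restrictedProduct (fun i => (hne i).2.1)
        (hx.mono fun i hi => (hmem i hi).2.2.2.1)
    · exact isUnit_restrictedProduct (fun i => (hne i).2.2.1)
        (hx.mono fun i hi => (hmem i hi).2.2.2.2.1)
    · exact isUnit_restrictedProduct (fun i => (hne i).2.2.2)
        (hx.mono fun i hi => (hmem i hi).2.2.2.2.2)
  · obtain ⟨p, q, hpq⟩ := h
    have hpq : ∀ i, p i * a i + q i * c i = 1 := fun i => congrArg (fun x => x i) hpq
    -- The Bézout coefficients must be integral too, for a and c to be coprime in `O i` and not
    -- merely in `F i`.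
    have hloc : ∀ i, ∃ s : F i, c i + s * a i ≠ 0 ∧
        (a i ∈ O i ∧ c i ∈ O i ∧ p i ∈ O i ∧ q i ∈ O i → s ∈ O i ∧ (c i + s * a i)⁻¹ ∈ O i) := by
      intro i
      by_cases hi : a i ∈ O i ∧ c i ∈ O i ∧ p i ∈ O i ∧ q i ∈ O i
      · obtain ⟨s, hs⟩ := exists_isUnit_add_mul_of_isCoprime
          (a := (⟨a i, hi.1⟩ : O i)) (c := ⟨c i, hi.2.1⟩)
          ⟨⟨p i, hi.2.2.1⟩, ⟨q i, hi.2.2.2⟩, Subtype.ext (hpq i)⟩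
        have hs := ne_zero_and_inv_mem_of_isUnit hs
        exact ⟨s, hs.1, fun _ => ⟨s.2, hs.2⟩⟩
      · obtain ⟨s, hs⟩ := exists_isUnit_add_mul_of_isCoprime ⟨p i, q i, hpq i⟩
        exact ⟨s, hs.ne_zero, fun h => absurd h hi⟩
    choose s hne hmem using hloc
    have hev := a.eventually.and (c.eventually.and (p.eventually.and q.eventually))
    exact ⟨⟨s, hev.mono fun i hi => (hmem i hi).1⟩,
      isUnit_restrictedProduct hne (hev.mono fun i hi => (hmem i hi).2)⟩

end Restricted

end SpecialLinearTwo

/-! ### Valuations of number fields -/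

namespace GlobalField

open IsDedekindDomain WithZero
open scoped NumberField

section NumberField

variable {K : Type*} [Field K]

/-- Valuation rings are integrally closed. -/
theorem valuation_ringOfIntegers_le_one (v : Valuation K ℤᵐ⁰) (r : 𝓞 K) :
    v (algebraMap (𝓞 K) K r) ≤ 1 :=
  (Valuation.integer.integers v).mem_of_integral
    ((NumberField.RingOfIntegers.isIntegral_coe r).tower_top (A := v.integer))

theorem valued_coe (v : Valuation K ℤᵐ⁰) (x : K) :
    Valued.v (x : v.Completion) = v x :=
  Valued.valuedCompletion_apply _

theorem coe_natCast (v : Valuation K ℤᵐ⁰) (m : ℕ) : ((m : K) : v.Completion) = m :=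
  map_natCast (UniformSpace.Completion.coeRingHom.comp (WithVal.equiv v).symm.toRingHom) m

variable [NumberField K]

/-- The prime ideal of the integers of valuation less than one. -/
theorem exists_heightOneSpectrum (v : Valuation K ℤᵐ⁰) (hv : Function.Surjective v) :
    ∃ P : HeightOneSpectrum (𝓞 K), ∀ r : 𝓞 K, r ∈ P.asIdeal ↔ v (algebraMap (𝓞 K) K r) < 1 := by
  have hle := valuation_ringOfIntegers_le_one v
  let I : Ideal (𝓞 K) :=
    { carrier := {r | v (algebraMap (𝓞 K) K r) < 1}
      add_mem' := fun {a b} ha hb => by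
        rw [Set.mem_ofPred_eq, map_add]
        exact v.map_add_lt ha hb
      zero_mem' := by simp
      smul_mem' := fun c x hx => by
        rw [Set.mem_ofPred_eq, smul_eq_mul, map_mul, map_mul]
        exact (mul_le_of_le_one_left' (hle c)).trans_lt hx }
  have hI : ∀ r, r ∈ I ↔ v (algebraMap (𝓞 K) K r) < 1 := fun r => Iff.rfl
  refine ⟨⟨I, ⟨?_, ?_⟩, ?_⟩, hI⟩
  · rw [Ideal.ne_top_iff_one, hI]
    simp
  · intro x y hxy
    by_contra! h
    rw [hI, not_lt, hI, not_lt] at h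
    rw [hI, map_mul, map_mul] at hxy
    exact absurd hxy (not_lt.2 (one_le_mul h.1 h.2))
  -- An element of valuation `exp (-1)` is a fraction n/d of integers, and its numerator is a
  -- nonzero element of the ideal.
  · obtain ⟨x, hx⟩ := hv (exp (-1))
    obtain ⟨n, d, hd, rfl⟩ := IsFractionRing.div_surjective (A := 𝓞 K) x
    have hd0 : algebraMap (𝓞 K) K d ≠ 0 := by simpa using nonZeroDivisors.ne_zero hd
    have hn : v (algebraMap (𝓞 K) K n) = exp (-1) * v (algebraMap (𝓞 K) K d) := by
      rw [← hx, ← map_mul, div_mul_cancel₀ _ hd0]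
    refine fun h => ?_
    have hlt : n ∈ I := by
      rw [hI, hn]
      exact (mul_le_of_le_one_right' (hle d)).trans_lt (by rw [← exp_zero, exp_lt_exp]; decide)
    rw [h, Ideal.mem_bot] at hlt
    rw [hlt, map_zero, map_zero] at hn
    exact mul_ne_zero exp_ne_zero ((v.ne_zero_iff).2 hd0) hn.symm

/-- Every normalized discrete valuation of a number field belongs to a prime ideal. -/
theorem exists_eq_valuation (v : Valuation K ℤᵐ⁰) (hv : Function.Surjective v) :
    ∃ P : HeightOneSpectrum (𝓞 K), v = P.valuation K := by
  obtain ⟨P, hP⟩ := exists_heightOneSpectrum v hv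
  refine ⟨P, ?_⟩
  -- A P-integral element has a denominator outside P, which is a unit for both valuations.
  have hfrac : ∀ x : K, P.valuation K x ≤ 1 → ∃ n : 𝓞 K,
      v x = v (algebraMap (𝓞 K) K n) ∧ P.valuation K x = P.valuation K (algebraMap (𝓞 K) K n) := by
    intro x hx
    obtain ⟨n, ⟨d, hd⟩, hnd⟩ := P.exists_primeCompl_mul_eq_of_integer x hx
    have h1 : v (algebraMap (𝓞 K) K d) = 1 :=
      le_antisymm (valuation_ringOfIntegers_le_one v d) (not_lt.1 fun h => hd ((hP d).2 h))
    have h2 : P.valuation K (algebraMap (𝓞 K) K d) = 1 :=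
      le_antisymm (P.valuation_le_one d)
        (not_lt.1 fun h => hd ((P.valuation_lt_one_iff_mem d).1 h))
    refine ⟨n, ?_, ?_⟩
    · rw [← hnd, map_mul, h1, mul_one]
    · rw [← hnd, map_mul, h2, mul_one]
  have hle : ∀ x, P.valuation K x ≤ 1 → v x ≤ 1 := fun x hx => by
    obtain ⟨n, h, -⟩ := hfrac x hx
    exact h ▸ valuation_ringOfIntegers_le_one v n
  have hone : ∀ x, P.valuation K x = 1 → v x = 1 := fun x hx => by
    refine le_antisymm (hle x hx.le) ?_
    have h := hle x⁻¹ (by rw [map_inv₀, hx, inv_one])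
    have hx0 : x ≠ 0 := by rintro rfl; simp at hx
    rwa [map_inv₀, inv_le_one₀ (zero_lt_iff.2 ((v.ne_zero_iff).2 hx0))] at h
  obtain ⟨π, hπ⟩ := P.valuation_exists_uniformizer K
  have hπ0 : π ≠ 0 := by rintro rfl; exact exp_ne_zero (hπ.symm.trans (map_zero _))
  have hπlt : v π < 1 := by
    have hlt : P.valuation K π < 1 := by rw [hπ, ← exp_zero, exp_lt_exp]; decide
    obtain ⟨n, h, h'⟩ := hfrac π hlt.le
    rw [h, ← hP, ← P.valuation_lt_one_iff_mem (K := K)]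
    exact h' ▸ hlt
  -- Multiplying x by a suitable power of the uniformizer π makes it a P-unit, hence a unit for v.
  have hpow : ∀ x, x ≠ 0 → v x = v π ^ (-log (P.valuation K x)) := by
    intro x hx
    have hx' := ((P.valuation K).ne_zero_iff).2 hx
    have h := hone (x * π ^ log (P.valuation K x)) (by
      rw [map_mul, map_zpow₀, hπ, ← exp_zsmul, smul_eq_mul, mul_neg, mul_one, exp_neg,
        exp_log hx', mul_inv_cancel₀ hx'])
    rw [map_mul, map_zpow₀] at h
    rw [zpow_neg]
    exact eq_inv_of_mul_eq_one_left h
  have hπ' := (v.ne_zero_iff).2 hπ0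
  obtain ⟨y, hy⟩ := hv (exp (-1))
  have hy0 : y ≠ 0 := by rintro rfl; exact exp_ne_zero (hy.symm.trans (map_zero _))
  -- Surjectivity of v makes -1 a multiple of `log (v π)`, which is therefore ±1; it is negative.
  have hlog : log (v π) = -1 := by
    have h1 := congrArg log ((hpow y hy0).symm.trans hy)
    rw [log_zpow, log_exp, smul_eq_mul] at h1
    have h2 : log (v π) < 0 := by
      rw [← log_one]
      exact (log_lt_log hπ' one_ne_zero).2 hπlt
    have h3 : IsUnit (log (v π)) := isUnit_iff_exists_inv'.2
      ⟨log (P.valuation K y), by linarith⟩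
    rcases Int.isUnit_iff.1 h3 with h | h
    · rw [h] at h2
      exact absurd h2 (by decide)
    · exact h
  have hvπ : v π = exp (-1) := by rw [← hlog, exp_log hπ']
  ext x
  by_cases hx : x = 0
  · simp [hx]
  · rw [hpow x hx, hvπ, ← exp_zsmul, smul_eq_mul, neg_mul_neg, mul_one,
      exp_log (((P.valuation K).ne_zero_iff).2 hx)]

/-- Such places come from the finitely many prime divisors of the ideal (m). -/
theorem finite_setOf_finitePlace_lt_one {m : ℕ} (hm : m ≠ 0) :
    {v : FinitePlace K | v.1 (m : K) < 1}.Finite := by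
  have hI : Ideal.span {(m : 𝓞 K)} ≠ 0 := by
    simpa [Ideal.span_singleton_eq_bot] using hm
  refine ((Ideal.finite_factors hI).image fun P =>
    (⟨P.valuation K, P.valuation_surjective K⟩ : FinitePlace K)).subset ?_
  rintro ⟨v, hv⟩ hvm
  obtain ⟨P, rfl⟩ := exists_eq_valuation v hv
  refine ⟨P, ?_, rfl⟩
  rw [Set.mem_ofPred_eq, Ideal.dvd_span_singleton, ← P.valuation_lt_one_iff_mem (K := K)]
  simpa using! hvm

/-- An integer of the completion is congruent to a global integer modulo `m`. -/
theorem exists_ringOfIntegers_sub_le {m : ℕ} (hm : m ≠ 0) (P : HeightOneSpectrum (𝓞 K))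
    {z : (P.valuation K).Completion} (hz : Valued.v z ≤ (1 : ℤᵐ⁰)) :
    ∃ a : 𝓞 K, Valued.v (z - ((algebraMap (𝓞 K) K a : K) : (P.valuation K).Completion)) ≤
      P.valuation K (m : K) := by
  have hmK : P.valuation K (m : K) ≠ 0 := by simpa using hm
  set M : (P.valuation K).Completion := ((m : K) : (P.valuation K).Completion) with hM
  have hMv : Valued.v M = P.valuation K (m : K) := valued_coe _ _
  -- The valuation is locally constant at M ≠ 0. If z - y + M has the valuation of M, the
  -- ultrametric inequality bounds z - y by that of M, so density of K gives an approximation of the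
  -- required quality.
  have hnhds : (fun y => z - y + M) ⁻¹' {y | Valued.v y = Valued.v M} ∈ nhds z := by
    have hc : Continuous fun y : (P.valuation K).Completion => z - y + M := by fun_prop
    refine hc.continuousAt.preimage_mem_nhds ?_
    simpa using Valued.locally_const (x := M) (by rw [hMv]; exact hmK)
  obtain ⟨y, hy⟩ :=
    (UniformSpace.Completion.denseRange_coe (α := WithVal (P.valuation K))).mem_nhds hnhds
  obtain ⟨x, rfl⟩ := (WithVal.equiv (P.valuation K)).symm.surjective y
  change Valued.v (z - (x : (P.valuation K).Completion) + M) = Valued.v M at hy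
  have hzx : Valued.v (z - (x : (P.valuation K).Completion)) ≤ P.valuation K (m : K) := by
    have h := Valued.v.map_sub (z - (x : (P.valuation K).Completion) + M) M
    rwa [add_sub_cancel_right, hy, max_self, hMv] at h
  have hx : P.valuation K x ≤ 1 := by
    have h := Valued.v.map_sub z (z - (x : (P.valuation K).Completion))
    rw [sub_sub_cancel, valued_coe] at h
    refine h.trans (max_le hz (hzx.trans ?_))
    simpa using P.valuation_le_one (K := K) (m : 𝓞 K)
  obtain ⟨a, ha⟩ := P.exists_valuation_sub_lt_of_integer hx (Units.mk0 _ hmK)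
  refine ⟨a, ?_⟩
  have h := Valued.v.map_sub (z - (x : (P.valuation K).Completion))
    ((algebraMap (𝓞 K) K a - x : K) : (P.valuation K).Completion)
  rw [valued_coe] at h
  refine le_trans (le_of_eq (congrArg _ ?_)) (h.trans (max_le hzx ha.le))
  have hs : ((algebraMap (𝓞 K) K a - x : K) : (P.valuation K).Completion) =
      ((algebraMap (𝓞 K) K a : K) : (P.valuation K).Completion) - (x : K) := by
    rw [map_sub, UniformSpace.Completion.coe_sub]
  rw [hs]
  ring

/-- Local integers are congruent to global ones modulo m, and `𝓞 K` modulo m is finite. -/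
theorem exists_finset_residues_completion {m : ℕ} (hm : m ≠ 0) (v : FinitePlace K) :
    ∃ F : Finset (Valued.v : Valuation v.1.Completion ℤᵐ⁰).integer,
      ∀ x, ∃ c ∈ F, ∃ y, x = c + m * y := by
  classical
  obtain ⟨v, hv⟩ := v
  obtain ⟨P, rfl⟩ := exists_eq_valuation v hv
  have hmK : P.valuation K (m : K) ≠ 0 := by simpa using hm
  have hI : Ideal.span {(m : 𝓞 K)} ≠ ⊥ := by simpa [Ideal.span_singleton_eq_bot] using hm
  have := Ideal.finiteQuotientOfFreeOfNeBot _ hI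
  let O := (Valued.v : Valuation (P.valuation K).Completion ℤᵐ⁰).integer
  have hint : ∀ a : 𝓞 K, ((algebraMap (𝓞 K) K a : K) : (P.valuation K).Completion) ∈ O :=
    fun a => (valued_coe _ _).trans_le (P.valuation_le_one a)
  have hfin := Set.finite_range fun q : 𝓞 K ⧸ Ideal.span {(m : 𝓞 K)} =>
    (⟨_, hint (Quotient.out q)⟩ : O)
  refine ⟨hfin.toFinset, fun z => ?_⟩
  obtain ⟨a, ha⟩ := exists_ringOfIntegers_sub_le hm P z.2
  set r := Quotient.out (Ideal.Quotient.mk (Ideal.span {(m : 𝓞 K)}) a) with hr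
  obtain ⟨b, hb⟩ := Ideal.mem_span_singleton'.1
    (Ideal.Quotient.eq.1 (Ideal.Quotient.mk_out (Ideal.Quotient.mk (Ideal.span {(m : 𝓞 K)}) a)))
  have hM0 : (m : (P.valuation K).Completion) ≠ 0 := by
    intro h
    have h' := valued_coe (P.valuation K) (m : K)
    rw [coe_natCast, h, map_zero] at h'
    exact hmK h'.symm
  have hMv : Valued.v (m : (P.valuation K).Completion) = P.valuation K (m : K) :=
    (congrArg _ (coe_natCast _ m)).symm.trans (valued_coe _ _)
  have hq : ((z : (P.valuation K).Completion) -
      ((algebraMap (𝓞 K) K a : K) : (P.valuation K).Completion)) / m ∈ O := by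
    change Valued.v _ ≤ (1 : ℤᵐ⁰)
    rw [map_div₀, hMv]
    exact div_le_one_of_le₀ ha zero_le
  have hra : ((algebraMap (𝓞 K) K r : K) : (P.valuation K).Completion) =
      (algebraMap (𝓞 K) K a : K) + (algebraMap (𝓞 K) K b : K) * m := by
    have h : r = a + b * m := by linear_combination -hb
    rw [h, map_add, map_mul, map_natCast, map_add, map_mul,
      UniformSpace.Completion.coe_add, UniformSpace.Completion.coe_mul, coe_natCast]
  refine ⟨⟨_, hint r⟩, by simp [hr], ⟨_, hq⟩ - ⟨_, hint b⟩, Subtype.ext ?_⟩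
  change (z : (P.valuation K).Completion) =
    ((algebraMap (𝓞 K) K r : K) : (P.valuation K).Completion) + (m : O) * (_ / m - _)
  rw [hra, Subring.coe_natCast, mul_sub, mul_div_cancel₀ _ hM0]
  ring

end NumberField

/-! ### The completions at the places of a global field -/

section Place

variable {K : Type*} [Field K]

/-- The embedding of `K` in its completion. -/
noncomputable def Place.embedding : (v : Place K) → K →+* v.Completion
  | .inl v => UniformSpace.Completion.coeRingHom.comp
      (WithVal.equiv v.1).symm.toRingHom
  | .inr w => algebraMap K w.Completion

theorem Place.natCast_ne_zero (v : Place K) {n : ℕ} (hn : (n : K) ≠ 0) :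
    (n : v.Completion) ≠ 0 := by
  rw [← map_natCast v.embedding]
  exact (map_ne_zero _).2 hn

theorem Place.mem_integers_or_inv_mem (v : Place K) (x : v.Completion) :
    x ∈ v.integers ∨ x⁻¹ ∈ v.integers := by
  cases v with
  | inl v => exact (Valued.v : Valuation v.1.Completion ℤᵐ⁰).valuationSubring.mem_or_inv_mem x
  | inr w => exact .inl trivial

theorem inv_natCast_mem_integers (v : FinitePlace K) {m : ℕ} (h : 1 ≤ v.1 (m : K)) :
    (m : Place.Completion (.inl v))⁻¹ ∈ Place.integers (.inl v) := by
  have hm : Valued.v (m : v.1.Completion) = v.1 (m : K) :=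
    (congrArg _ (coe_natCast _ m)).symm.trans (valued_coe _ _)
  change Valued.v (m : v.1.Completion)⁻¹ ≤ (1 : ℤᵐ⁰)
  rw [map_inv₀, hm]
  exact inv_le_one_of_one_le₀ h

/-- For positive characteristic: there the inverse of m is itself the image of a natural number,
hence integral everywhere. -/
theorem Place.inv_natCast_mem_of_mul_eq_one (v : Place K) {m n : ℕ} (h : (m * n : K) = 1) :
    (m : v.Completion)⁻¹ ∈ v.integers := by
  have h' := congrArg v.embedding h
  rw [map_mul, map_natCast, map_natCast, map_one] at h'
  rw [inv_eq_of_mul_eq_one_right h']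
  exact natCast_mem _ _

theorem Place.inv_natCast_mem_iff_isUnit (v : Place K) {m : ℕ} (hm : (m : K) ≠ 0) :
    (m : v.Completion)⁻¹ ∈ v.integers ↔ IsUnit (m : v.integers) := by
  constructor
  · intro h
    refine IsUnit.of_mul_eq_one ⟨_, h⟩ (Subtype.ext ?_)
    exact mul_inv_cancel₀ (v.natCast_ne_zero hm)
  · intro h
    exact (SpecialLinearTwo.ne_zero_and_inv_mem_of_isUnit h).2

theorem natCast_ne_zero_of_ringChar_ne {q : ℕ} (hq : q.Prime) (h : ringChar K ≠ q) :
    (q : K) ≠ 0 := by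
  intro h0
  rcases (Nat.dvd_prime hq).1 ((ringChar.spec K q).1 h0) with h1 | h1
  · exact CharP.ringChar_ne_one h1
  · exact h h1

theorem IsGlobalField.numberField (hK : IsGlobalField K) (h : ringChar K = 0) : NumberField K := by
  rcases hK with hK | ⟨p, hp, hK, -⟩
  · exact hK
  · have hp0 : (p : K) = 0 := by
      rw [← map_natCast (algebraMap (RatFunc (ZMod p)) K),
        ← map_natCast (algebraMap (ZMod p) (RatFunc (ZMod p)))]
      simp
    have h' := (ringChar.spec K p).1 hp0
    rw [h, zero_dvd_iff] at h'
    exact absurd h' hp.out.ne_zero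

/-- Only finitely many places divide a given nonzero integer, and its residue rings are finite. -/
theorem IsGlobalField.finite_places_and_residues (hK : IsGlobalField K) {m : ℕ}
    (hm : (m : K) ≠ 0) :
    {v : Place K | ¬ (m : v.Completion)⁻¹ ∈ v.integers}.Finite ∧
      ∀ v : Place K, ¬ (m : v.Completion)⁻¹ ∈ v.integers →
        ∃ F : Finset v.integers, ∀ x, ∃ c ∈ F, ∃ y, x = c + m * y := by
  by_cases h0 : ringChar K = 0
  · have := hK.numberField h0
    have hm' : m ≠ 0 := by rintro rfl; simp at hm
    constructor
    · refine ((finite_setOf_finitePlace_lt_one (K := K) hm').image Sum.inl).subset ?_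
      rintro (v | w) hv
      · exact ⟨v, not_le.1 fun h => hv (inv_natCast_mem_integers v h), rfl⟩
      · exact absurd trivial hv
    · rintro (v | w) hv
      · exact exists_finset_residues_completion hm' v
      · exact absurd trivial hv
  · have hp : Fact (ringChar K).Prime :=
      ⟨(CharP.char_is_prime_or_zero K (ringChar K)).resolve_right h0⟩
    -- In positive characteristic m is invertible already in the prime field, so no place divides
    -- it.
    have hcop : Nat.Coprime m (ringChar K) := by
      rw [Nat.coprime_comm, hp.out.coprime_iff_not_dvd, ← ringChar.spec K]
      exact hm
    obtain ⟨n, hn⟩ : ∃ n : ℕ, (m * n : K) = 1 := by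
      refine ⟨((m : ZMod (ringChar K))⁻¹).val, ?_⟩
      have h := ZMod.coe_mul_inv_eq_one m hcop
      have h' := congrArg (ZMod.castHom dvd_rfl K) h
      rw [map_mul, map_natCast, map_one, ZMod.castHom_apply, ZMod.cast_eq_val] at h'
      exact h'
    have hall := fun v : Place K => v.inv_natCast_mem_of_mul_eq_one hn
    exact ⟨by simp [hall], fun v hv => absurd (hall v) hv⟩

end Place

end GlobalField

/-! ### Adele rings and products of local integers -/

open GlobalField SpecialLinearTwo in
theorem mainTheorem8 (K : Type*) [Field K] (hK : GlobalField.IsGlobalField K)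
    (h2 : ringChar K ≠ 2) (h3 : ringChar K ≠ 3) (h5 : ringChar K ≠ 5) :
    BiInterpretableWithSL2s (GlobalField.AdeleRing K) ∧
    ∀ P : Set (GlobalField.Place K), P.Nonempty →
      BiInterpretableWithSL2s (GlobalField.IntegerProduct P) := by
  have h2' := natCast_ne_zero_of_ringChar_ne Nat.prime_two h2
  have h3' := natCast_ne_zero_of_ringChar_ne Nat.prime_three h3
  have h5' := natCast_ne_zero_of_ringChar_ne Nat.prime_five h5
  have h24 : ((24 : ℕ) : K) ≠ 0 := by
    convert mul_ne_zero (pow_ne_zero 3 h2') h3' using 1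
    norm_num
  obtain ⟨hfin, hres⟩ := hK.finite_places_and_residues h24
  refine ⟨UnitRich.biInterpretable (UnitRich.restrictedProduct
    (fun v => v.mem_integers_or_inv_mem) (fun v => by exact_mod_cast v.natCast_ne_zero h2')
    (fun v => by exact_mod_cast v.natCast_ne_zero h3')
    (fun v => by exact_mod_cast v.natCast_ne_zero h5') ?_), fun P _ => ?_⟩
  · rw [Filter.eventually_cofinite]
    exact_mod_cast hfin
  · have hloc : ∀ v : P, IsLocalRing (v : Place K).integers := fun v =>
      isLocalRing_of_mem_or_inv_mem v.1.mem_integers_or_inv_mem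
    have hne : ∀ (v : P) {n : ℕ}, (n : K) ≠ 0 → (n : (v : Place K).integers) ≠ 0 :=
      fun v n hn h => v.1.natCast_ne_zero hn (congrArg Subtype.val h)
    refine UnitRich.biInterpretable (UnitRich.pi (fun v => by exact_mod_cast hne v h2')
      (fun v => by exact_mod_cast hne v h3') (fun v => by exact_mod_cast hne v h5') ?_)
    refine exists_finset_residues_pi (m := 24) ?_ fun v hv => ?_
    · refine (hfin.preimage Subtype.val_injective.injOn).subset fun v hv => ?_
      exact fun h => hv ((v.1.inv_natCast_mem_iff_isUnit h24).1 h)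
    · exact hres v fun h => hv ((v.1.inv_natCast_mem_iff_isUnit h24).1 h)
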